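/- Let $n\ge 1$. A dyadic grid $\mathcal D$ in $\mathbb R^n$ is a family of half-open axis-parallel cubes with side lengths $\ell(Q)\in\{2^j: j\in\mathbb Z\}$, any two of which are disjoint or nested, such that for each $j\in\mathbb Z$ the cubes of side length $2^j$ partition $\mathbb R^n$. A generalized Haar function associated with $Q\in\mathcal D$ is a function that vanishes outside $Q$, is constant on each $Q'\in\mathcal D$ with $Q'\subsetneq Q$, and is bounded by $1$ in absolute value. For integers $m,k\ge 0$, a generalized Haar shift operator of complexity type $(m,k)$ on $\mathcal D$ is a bounded linear operator $S$ on $L^2(\mathbb R^n)$ of the form $$Sf=\sum_{Q\in\mathcal D}S_Qf,\qquad S_Qf(x)=\sum_{\substack{Q'\in\mathcal D_m(Q)\\ Q''\in\mathcal D_k(Q)}}\frac{\langle f,g_{Q'}^{Q''}\rangle}{|Q|}\,g_{Q''}^{Q'}(x),$$ where $\mathcal D_j(Q)$ is the set of cubes of $\mathcal D$ contained in $Q$ with side length $2^{-j}\ell(Q)$, and $g_{Q'}^{Q''}$, $g_{Q''}^{Q'}$ are generalized Haar functions associated with $Q'$ and with $Q''$, respectively; the sum over $Q$ is the limit (locally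 in measure) of the truncations $S_{\epsilon,\epsilon'}f=\sum_{Q\in\mathcal D,\ \epsilon\le\ell(Q)\le\epsilon'}S_Qf$ as $\epsilon\to0$, $\epsilon'\to\infty$. Its complexity is $\kappa=\max(m,k)$. Put $$S_\star f(x)=\sup_{0<\epsilon<\epsilon'<\infty}|S_{\epsilon,\epsilon'}f(x)|,\qquad M_{\mathcal D}f(x)=\sup_{x\in Q\in\mathcal D}\frac1{|Q|}\int_Q|f|.$$ Let $1<p<q<\infty$, with conjugate exponents $p',q'$, and let $(u,v)$ be a pair of measurable functions with values in $[0,\infty]$ such that $u>0$ on a set of positive measure, $u<\infty$ a.e., $v>0$ a.e., and $v<\infty$ on a set of positive measure (with $0\cdot\infty=0$). (i) If $M_{\mathcal D}$ is bounded $L^p(v)\to L^q(u)$ with norm at most $A$ and $L^{q'}(u^{1-q'})\to L^{p'}(v^{1-p'})$ with norm at most $B$, then for all $f\in L^p(v)$ $$\|Sf\|_{L^q(u)}\le C\max(1,\kappa)^2\|f\|_{L^p(v)},\qquad \|S_\star f\|_{L^q(u)}\le C\max(1,\kappa)^2\|f\|_{L^p(v)},$$ where $C$ depends only on $n,p,q,A,B$.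 (ii) If only the second of these two bounds for $M_{\mathcal D}$ is assumed, with norm at most $B$, then for all $f\in L^p(v)$ $$\|Sf\|_{L^{q,\infty}(u)}\le C\max(1,\kappa)^2\|f\|_{L^p(v)},\qquad \|S_\star f\|_{L^{q,\infty}(u)}\le C\max(1,\kappa)^2\|f\|_{L^p(v)},$$ where $C$ depends only on $n,p,q,B$. Here, for $f\in L^p(v)$, $Sf(x)$ is the limit of $S_{\epsilon,\epsilon'}f(x)$ as $\epsilon\to0$, $\epsilon'\to\infty$; part of the assertion is that this limit exists for $u\,dx$-almost every $x$ and agrees $u\,dx$-almost everywhere with the image of $f$ under the operator on $L^2(\mathbb R^n)$ if $f\in L^2(\mathbb R^n)$. -/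

import Mathlib

open MeasureTheory Filter Topology
open scoped ENNReal NNReal

/-- A half-open cube `∏ᵢ [aᵢ, aᵢ + 2^j)` in `ℝⁿ`, given by its lower corner `a` and by the
integer `j`; its side length is `2^j`. -/
structure DyadicCube (n : ℕ) where
  corner : Fin n → ℝ
  scale : ℤ

namespace DyadicCube

variable {n : ℕ}

/-- The side length `ℓ(Q) = 2^j`. -/
noncomputable def side (Q : DyadicCube n) : ℝ := (2 : ℝ) ^ Q.scale

/-- The cube as a set of points. -/
def toSet (Q : DyadicCube n) : Set (Fin n → ℝ) :=
  {x | ∀ i, Q.corner i ≤ x i ∧ x i < Q.corner i + Q.side}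

end DyadicCube

/-- A (generalized) dyadic grid in `ℝⁿ`: a family of cubes whose side lengths are powers of two,
any two of which are disjoint or nested, and such that for each `j : ℤ` the cubes of side length
`2^j` partition `ℝⁿ`. -/
structure DyadicGrid (n : ℕ) where
  cubes : Set (DyadicCube n)
  nested : ∀ Q ∈ cubes, ∀ R ∈ cubes, (Q.toSet ∩ R.toSet).Nonempty →
    Q.toSet ⊆ R.toSet ∨ R.toSet ⊆ Q.toSet
  partition : ∀ (j : ℤ) (x : Fin n → ℝ), ∃! Q : DyadicCube n,
    Q ∈ cubes ∧ Q.scale = j ∧ x ∈ Q.toSet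

namespace DyadicGrid

variable {n : ℕ}

/-- `𝓓_j(Q)`: the cubes of the grid contained in `Q` of side length `2^{-j} ℓ(Q)`. -/
def descendants (D : DyadicGrid n) (j : ℕ) (Q : DyadicCube n) : Set (DyadicCube n) :=
  {Q' | Q' ∈ D.cubes ∧ Q'.toSet ⊆ Q.toSet ∧ Q'.scale = Q.scale - j}

variable {𝕜 : Type*} [RCLike 𝕜]

/-- `g` is a generalized Haar function associated with the cube `Q` of the grid: it vanishes
outside `Q`, is constant on each cube of the grid strictly contained in `Q`, and is bounded
by `1`. -/
structure IsGenHaar (D : DyadicGrid n) (Q : DyadicCube n) (g : (Fin n → ℝ) → 𝕜) : Prop where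
  eq_zero_of_notMem : ∀ x, x ∉ Q.toSet → g x = 0
  const : ∀ Q' ∈ D.cubes, Q'.toSet ⊂ Q.toSet → ∀ x ∈ Q'.toSet, ∀ y ∈ Q'.toSet, g x = g y
  norm_le_one : ∀ x, ‖g x‖ ≤ 1

/-- The dyadic maximal function `M_𝓓 f(x) = sup_{x ∈ Q ∈ 𝓓} |Q|⁻¹ ∫_Q |f|`. -/
noncomputable def maximal (D : DyadicGrid n) (f : (Fin n → ℝ) → 𝕜) (x : Fin n → ℝ) : ℝ≥0∞ :=
  ⨆ (Q : DyadicCube n) (_ : Q ∈ D.cubes) (_ : x ∈ Q.toSet),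
    (∫⁻ y in Q.toSet, ‖f y‖ₑ) / volume Q.toSet

/-- The piece `S_Q f(x) = ∑_{Q' ∈ 𝓓_m(Q)} ∑_{Q'' ∈ 𝓓_k(Q)} |Q|⁻¹ ⟨f, a Q' Q''⟩ b Q' Q'' (x)`.
Both sums are finite. -/
noncomputable def shiftPiece (D : DyadicGrid n) (m k : ℕ)
    (a b : DyadicCube n → DyadicCube n → (Fin n → ℝ) → 𝕜) (Q : DyadicCube n)
    (f : (Fin n → ℝ) → 𝕜) (x : Fin n → ℝ) : 𝕜 :=
  ∑ᶠ Q' ∈ D.descendants m Q, ∑ᶠ Q'' ∈ D.descendants k Q,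
    (∫ y, f y * starRingEnd 𝕜 (a Q' Q'' y)) / ((volume.real Q.toSet : ℝ) : 𝕜) * b Q' Q'' x

/-- The truncated sum `S_{ε,ε'} f(x) = ∑_{Q ∈ 𝓓, ε ≤ ℓ(Q) ≤ ε'} S_Q f(x)`. When each `b Q' Q''`
vanishes outside `Q''` and `0 < ε`, only the finitely many such `Q` containing `x` contribute. -/
noncomputable def shiftTrunc (D : DyadicGrid n) (m k : ℕ)
    (a b : DyadicCube n → DyadicCube n → (Fin n → ℝ) → 𝕜) (ε ε' : ℝ)
    (f : (Fin n → ℝ) → 𝕜) (x : Fin n → ℝ) : 𝕜 :=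
  ∑ᶠ Q ∈ {Q : DyadicCube n | Q ∈ D.cubes ∧ ε ≤ Q.side ∧ Q.side ≤ ε'},
    D.shiftPiece m k a b Q f x

end DyadicGrid

/-- A generalized Haar shift operator of complexity type `(m, k)` on the grid `D`: a bounded linear
operator on `L²(ℝⁿ)` with `S f = ∑_{Q ∈ 𝓓} S_Q f`. Here `a Q' Q''` and `b Q' Q''` are generalized
Haar functions associated with `Q'` and with `Q''` respectively. The sum is the limit, locally in
measure, of the truncated sums `S_{ε,ε'} f` as `ε → 0`, `ε' → ∞` (this is implied by convergence
almost everywhere and by convergence in `L²`). -/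
structure HaarShift (𝕜 : Type*) [RCLike 𝕜] {n : ℕ} (D : DyadicGrid n) (m k : ℕ) where
  op : Lp 𝕜 2 (volume : Measure (Fin n → ℝ)) →L[𝕜] Lp 𝕜 2 (volume : Measure (Fin n → ℝ))
  a : DyadicCube n → DyadicCube n → (Fin n → ℝ) → 𝕜
  b : DyadicCube n → DyadicCube n → (Fin n → ℝ) → 𝕜
  haar_a : ∀ Q ∈ D.cubes, ∀ Q' ∈ D.descendants m Q, ∀ Q'' ∈ D.descendants k Q,
    D.IsGenHaar Q' (a Q' Q'')
  haar_b : ∀ Q ∈ D.cubes, ∀ Q' ∈ D.descendants m Q, ∀ Q'' ∈ D.descendants k Q,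
    D.IsGenHaar Q'' (b Q' Q'')
  tendsto_trunc : ∀ (f : Lp 𝕜 2 (volume : Measure (Fin n → ℝ))) (r : ℝ),
    TendstoInMeasure (volume.restrict (Metric.ball 0 r))
      (fun e : ℝ × ℝ => D.shiftTrunc m k a b e.1 e.2 (f : (Fin n → ℝ) → 𝕜))
      (𝓝[>] 0 ×ˢ atTop) (op f : (Fin n → ℝ) → 𝕜)

namespace HaarShift

variable {𝕜 : Type*} [RCLike 𝕜] {n : ℕ} {D : DyadicGrid n} {m k : ℕ}

/-- The complexity `κ = max(m, k)`. -/
def complexity (_S : HaarShift 𝕜 D m k) : ℕ := max m k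

/-- The truncation `S_{ε,ε'} f`. -/
noncomputable def trunc (S : HaarShift 𝕜 D m k) (ε ε' : ℝ) (f : (Fin n → ℝ) → 𝕜)
    (x : Fin n → ℝ) : 𝕜 :=
  D.shiftTrunc m k S.a S.b ε ε' f x

/-- The truncated Haar shift operator `S_⋆ f(x) = sup_{0 < ε < ε' < ∞} |S_{ε,ε'} f(x)|`. -/
noncomputable def maxTrunc (S : HaarShift 𝕜 D m k) (f : (Fin n → ℝ) → 𝕜)
    (x : Fin n → ℝ) : ℝ≥0∞ :=
  ⨆ (ε : ℝ) (ε' : ℝ) (_ : 0 < ε) (_ : ε < ε'), ‖S.trunc ε ε' f x‖ₑ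

end HaarShift

/-- The norm `‖F‖_{L^p(w)} = (∫ F^p w)^{1/p}` of a nonnegative function, with `0 · ∞ = 0`. -/
noncomputable def weightedNorm {n : ℕ} (p : ℝ) (w F : (Fin n → ℝ) → ℝ≥0∞) : ℝ≥0∞ :=
  (∫⁻ x, F x ^ p * w x) ^ (1 / p)

/-- The weak norm `‖F‖_{L^{q,∞}(w)} = sup_t t · w({F > t})^{1/q}` of a nonnegative function. -/
noncomputable def weightedWeakNorm {n : ℕ} (q : ℝ) (w F : (Fin n → ℝ) → ℝ≥0∞) : ℝ≥0∞ :=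
  ⨆ t : ℝ≥0, (t : ℝ≥0∞) * (∫⁻ x in {x | (t : ℝ≥0∞) < F x}, w x) ^ (1 / q)

/-- `f ∈ L^p(w)`. -/
def MemWeighted {𝕜 : Type*} [RCLike 𝕜] {n : ℕ} (p : ℝ) (w : (Fin n → ℝ) → ℝ≥0∞)
    (f : (Fin n → ℝ) → 𝕜) : Prop :=
  AEStronglyMeasurable f volume ∧ weightedNorm p w (fun x => ‖f x‖ₑ) < ∞

/-- A pair of weights `(u, v)`: measurable functions with values in `[0, ∞]` such that `u > 0` on a
set of positive measure, `u < ∞` a.e., `v > 0` a.e., and `v < ∞` on a set of positive measure. -/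
structure IsWeightPair {n : ℕ} (u v : (Fin n → ℝ) → ℝ≥0∞) : Prop where
  measurable_u : AEMeasurable u volume
  measurable_v : AEMeasurable v volume
  u_pos : volume {x | 0 < u x} ≠ 0
  u_lt_top : ∀ᵐ x, u x < ∞
  v_pos : ∀ᵐ x, 0 < v x
  v_lt_top : volume {x | v x < ∞} ≠ 0

/-- `M_𝓓 : L^r(w) → L^s(w')` with norm at most `A`. -/
def DyadicGrid.MaximalBound (𝕜 : Type*) [RCLike 𝕜] {n : ℕ} (D : DyadicGrid n) (r s : ℝ)
    (w w' : (Fin n → ℝ) → ℝ≥0∞) (A : ℝ≥0) : Prop :=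
  ∀ f : (Fin n → ℝ) → 𝕜, MemWeighted r w f →
    weightedNorm s w' (D.maximal f) ≤ A * weightedNorm r w (fun x => ‖f x‖ₑ)

/-- `g` is the value `S f` up to a set where `u dx` vanishes: the truncated sums of
`∑_Q S_Q f(x)` converge to `g(x)` for `u dx`-almost every `x`, and `g` agrees `u dx`-almost
everywhere with the image of `f` under the `L²` operator whenever `f ∈ L²`. -/
structure HaarShift.IsValue {𝕜 : Type*} [RCLike 𝕜] {n : ℕ} {D : DyadicGrid n} {m k : ℕ}
    (S : HaarShift 𝕜 D m k) (u : (Fin n → ℝ) → ℝ≥0∞) (f g : (Fin n → ℝ) → 𝕜) : Prop where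
  tendsto : ∀ᵐ x, u x ≠ 0 →
    Tendsto (fun e : ℝ × ℝ => S.trunc e.1 e.2 f x) (𝓝[>] 0 ×ˢ atTop) (𝓝 (g x))
  eq_op : ∀ hf : MemLp f 2 volume, ∀ᵐ x, u x ≠ 0 → S.op (hf.toLp f) x = g x

/-!
Off-diagonal estimates for generalized Haar shifts, by domination by a positive dyadic operator.

A single term of a Haar shift satisfies `|S_Q f| ≤ ⟨|f|⟩_Q 1_Q`, whatever its complexity: at a
given point one cube `Q''` contributes, and the cubes `Q'` are disjoint
(`HaarShift.enorm_piece_le`). Hence the truncations, their supremum and their limit are all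
dominated by the positive operator `T f(x) = ∑_{Q ∋ x} ⟨|f|⟩_Q`, the sum being over *all* cubes of
the grid. When `p = q` this operator is unbounded even without weights, but for `p < q` it satisfies
the two weight bounds. So neither the cancellation nor the `L²` bound of the shift is needed, and
the constant does not grow with the complexity.

By duality one has to bound the form `∑_Q F(Q) H(Q) / |Q|`, where `F = |f| dx` and `H = h dx`, by
`K Φ^{1/p} Ψ^{1/q'}`, with the total masses of `Φ = |f|^p v dx` and `Ψ = h^{q'} u^{1-q'} dx`. The
point is that `1/p + 1/q' > 1`. Fix a cube `Q₀` and let its chain be the family of those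
`Q ⊆ Q₀` with `Φ(Q) > Φ(Q₀)/2` and `Ψ(Q) > Ψ(Q₀)/2`; two disjoint cubes cannot both belong to it, so
the chain is totally ordered.

* The maximal cubes `R` outside the chain are disjoint and carry at most half of one of the two
  masses. As the exponents add up to more than one, `∑_R Φ(R)^{1/p} Ψ(R)^{1/q'}` is at most a
  fraction `ρ < 1` of the same quantity for `Q₀` (`energy_le_energyRatio_mul`,
  `tsum_energy_rpow_le`). An induction on the number of generations deals with these cubes.
* Along the chain, summation by parts reduces the form, since `1 / |Q|` grows geometrically, to
  integrals over the rings between consecutive cubes, which are at most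
  `∫_{Q₀} f M(h 1_{Q₀}) + h M(f 1_{Q₀})` (`two_mul_formTerm_le`, `localForm_add_formTerm_le`). The
  two maximal function bounds and Hölder's inequality control this by `Φ(Q₀)^{1/p} Ψ(Q₀)^{1/q'}`.

For the weak type one takes `h = u 1_E`, so that `Ψ = H`. Then the averages of `f` over the cubes of
the chain are already controlled by the estimate for a single cube, and the bound for `M` on `f` is
not needed (`lintegral_mul_posTrunc_le_of_eq_or_eq_zero`). The weak type also shows that `T f` is
finite `u dx`-almost everywhere, whence the series `∑_Q S_Q f(x)` converges absolutely there.
-/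

/-! ### Cubes and grids -/

namespace DyadicCube

variable {n : ℕ}

theorem side_pos (Q : DyadicCube n) : 0 < Q.side := zpow_pos two_pos _

theorem toSet_eq_pi (Q : DyadicCube n) :
    Q.toSet = Set.univ.pi fun i => Set.Ico (Q.corner i) (Q.corner i + Q.side) := by
  ext x; simp [toSet]

theorem measurableSet_toSet (Q : DyadicCube n) : MeasurableSet Q.toSet := by
  rw [toSet_eq_pi]
  exact MeasurableSet.univ_pi fun _ => measurableSet_Ico

theorem volume_toSet (Q : DyadicCube n) : volume Q.toSet = ENNReal.ofReal Q.side ^ n := by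
  rw [toSet_eq_pi, Real.volume_pi_Ico]
  simp

theorem volume_ne_zero (Q : DyadicCube n) : volume Q.toSet ≠ 0 := by
  rw [volume_toSet]
  exact pow_ne_zero _ (ENNReal.ofReal_pos.2 Q.side_pos).ne'

theorem volume_ne_top (Q : DyadicCube n) : volume Q.toSet ≠ ∞ := by
  rw [volume_toSet]
  exact ENNReal.pow_ne_top ENNReal.ofReal_ne_top

theorem interior_toSet_nonempty (Q : DyadicCube n) : (interior Q.toSet).Nonempty := by
  rw [toSet_eq_pi, interior_pi_set Set.finite_univ]
  refine ⟨fun i => Q.corner i + Q.side / 2, fun i _ => ?_⟩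
  have := Q.side_pos
  simp only [interior_Ico]
  constructor <;> linarith

theorem two_mul_volume_le (hn : 0 < n) {Q R : DyadicCube n} (h : Q.scale < R.scale) :
    2 * volume Q.toSet ≤ volume R.toSet := by
  have h1 : 2 * Q.side ≤ R.side := by
    have : (2 : ℝ) ^ (Q.scale + 1) ≤ 2 ^ R.scale := zpow_le_zpow_right₀ one_le_two h
    rwa [zpow_add_one₀ two_ne_zero, mul_comm] at this
  have h2 : 2 * ENNReal.ofReal Q.side ≤ ENNReal.ofReal R.side := by
    have := ENNReal.ofReal_le_ofReal h1
    rwa [ENNReal.ofReal_mul zero_le_two, ENNReal.ofReal_ofNat] at this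
  rw [volume_toSet, volume_toSet]
  calc 2 * ENNReal.ofReal Q.side ^ n ≤ 2 ^ n * ENNReal.ofReal Q.side ^ n := by
        gcongr
        exact le_self_pow₀ one_le_two hn.ne'
    _ = (2 * ENNReal.ofReal Q.side) ^ n := (mul_pow _ _ _).symm
    _ ≤ _ := by gcongr

theorem scale_le_of_subset (hn : 0 < n) {Q R : DyadicCube n} (h : Q.toSet ⊆ R.toSet) :
    Q.scale ≤ R.scale := by
  by_contra! hlt
  have h1 := (two_mul_volume_le hn hlt).trans (measure_mono h)
  have h2 : volume R.toSet < 2 * volume R.toSet := by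
    rw [two_mul]
    exact ENNReal.lt_add_right R.volume_ne_top R.volume_ne_zero
  exact absurd h1 (not_le.2 h2)

end DyadicCube

namespace DyadicGrid

variable {n : ℕ} (D : DyadicGrid n)

/-- The cube of the grid `D` of side length `2 ^ j` that contains the point `x`. -/
noncomputable def cubeAt (j : ℤ) (x : Fin n → ℝ) : DyadicCube n := (D.partition j x).choose

theorem cubeAt_mem (j : ℤ) (x : Fin n → ℝ) : D.cubeAt j x ∈ D.cubes :=
  (D.partition j x).choose_spec.1.1

@[simp] theorem scale_cubeAt (j : ℤ) (x : Fin n → ℝ) : (D.cubeAt j x).scale = j :=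
  (D.partition j x).choose_spec.1.2.1

theorem mem_cubeAt (j : ℤ) (x : Fin n → ℝ) : x ∈ (D.cubeAt j x).toSet :=
  (D.partition j x).choose_spec.1.2.2

variable {D}

theorem cubeAt_eq {Q : DyadicCube n} (hQ : Q ∈ D.cubes) {j : ℤ} (hj : Q.scale = j)
    {x : Fin n → ℝ} (hx : x ∈ Q.toSet) : D.cubeAt j x = Q :=
  ((D.partition j x).choose_spec.2 Q ⟨hQ, hj, hx⟩).symm

theorem disjoint_of_scale_eq {Q R : DyadicCube n} (hQ : Q ∈ D.cubes) (hR : R ∈ D.cubes)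
    (h : Q.scale = R.scale) (hne : Q ≠ R) : Disjoint Q.toSet R.toSet := by
  rw [Set.disjoint_left]
  intro x hx hx'
  exact hne ((cubeAt_eq hQ h hx).symm.trans (cubeAt_eq hR rfl hx'))

theorem cubeAt_subset (hn : 0 < n) {Q : DyadicCube n} (hQ : Q ∈ D.cubes) {x : Fin n → ℝ}
    (hx : x ∈ Q.toSet) {j : ℤ} (hj : j ≤ Q.scale) : (D.cubeAt j x).toSet ⊆ Q.toSet := by
  rcases D.nested _ (D.cubeAt_mem j x) _ hQ ⟨x, D.mem_cubeAt j x, hx⟩ with h | h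
  · exact h
  · have h1 := DyadicCube.scale_le_of_subset hn h
    rw [scale_cubeAt] at h1
    rw [cubeAt_eq hQ (le_antisymm h1 hj) hx]

variable (D)

theorem countable_cubes : D.cubes.Countable := by
  have h : D.cubes = ⋃ j : ℤ, {Q | Q ∈ D.cubes ∧ Q.scale = j} := by ext; simp
  rw [h]
  refine Set.countable_iUnion fun j => Set.PairwiseDisjoint.countable_of_nonempty_interior
    (s := DyadicCube.toSet) ?_ fun Q _ => Q.interior_toSet_nonempty
  intro Q hQ R hR hne
  exact disjoint_of_scale_eq hQ.1 hR.1 (hQ.2.trans hR.2.symm) hne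

instance countable_descendants (j : ℕ) (Q : DyadicCube n) : Countable (D.descendants j Q) :=
  (D.countable_cubes.mono fun _ h => h.1).to_subtype

/-- The cubes of the grid of side length `2 ^ j`. -/
def cubesOfScale (j : ℤ) : Set (DyadicCube n) := {Q | Q ∈ D.cubes ∧ Q.scale = j}

instance countable_cubesOfScale (j : ℤ) : Countable (D.cubesOfScale j) :=
  (D.countable_cubes.mono fun _ h => h.1).to_subtype

variable {D}

theorem pairwise_disjoint_descendants (j : ℕ) (Q : DyadicCube n) :
    Pairwise (Function.onFun Disjoint fun R : D.descendants j Q => R.1.toSet) := by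
  intro R R' hne
  exact disjoint_of_scale_eq R.2.1 R'.2.1 (R.2.2.2.trans R'.2.2.2.symm) fun h => hne (Subtype.ext h)

theorem pairwise_disjoint_cubesOfScale (j : ℤ) :
    Pairwise (Function.onFun Disjoint fun R : D.cubesOfScale j => R.1.toSet) := by
  intro R R' hne
  exact disjoint_of_scale_eq R.2.1 R'.2.1 (R.2.2.trans R'.2.2.symm) fun h => hne (Subtype.ext h)

theorem iUnion_descendants (hn : 0 < n) (j : ℕ) {Q : DyadicCube n} (hQ : Q ∈ D.cubes) :
    ⋃ R : D.descendants j Q, R.1.toSet = Q.toSet := by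
  refine subset_antisymm (Set.iUnion_subset fun R => R.2.2.1) fun x hx => ?_
  rw [Set.mem_iUnion]
  exact ⟨⟨D.cubeAt (Q.scale - j) x, D.cubeAt_mem _ _, cubeAt_subset hn hQ hx (by omega), by simp⟩,
    D.mem_cubeAt _ _⟩

theorem iUnion_cubesOfScale (j : ℤ) : ⋃ R : D.cubesOfScale j, R.1.toSet = Set.univ := by
  refine Set.eq_univ_of_forall fun x => Set.mem_iUnion.2 ?_
  exact ⟨⟨D.cubeAt j x, D.cubeAt_mem _ _, by simp⟩, D.mem_cubeAt _ _⟩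

/-- A function of `x` that depends only on the cube of a fixed scale containing `x` is measurable,
since the cubes of that scale form a countable measurable partition. -/
theorem measurable_comp_cubeAt {β : Type*} [MeasurableSpace β] (j : ℤ) (c : DyadicCube n → β) :
    Measurable fun x => c (D.cubeAt j x) := by
  intro s _
  have : (fun x => c (D.cubeAt j x)) ⁻¹' s =
      ⋃ Q ∈ {Q | Q ∈ D.cubesOfScale j ∧ c Q ∈ s}, Q.toSet := by
    ext x
    simp only [Set.mem_preimage, Set.mem_iUnion, Set.mem_ofPred_eq, exists_prop]
    constructor
    · intro h
      exact ⟨_, ⟨⟨D.cubeAt_mem j x, by simp⟩, h⟩, D.mem_cubeAt j x⟩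
    · rintro ⟨Q, ⟨hQ, h⟩, hx⟩
      rwa [cubeAt_eq hQ.1 hQ.2 hx]
  rw [this]
  exact MeasurableSet.biUnion (D.countable_cubes.mono fun _ h => h.1.1)
    fun Q _ => Q.measurableSet_toSet

end DyadicGrid

/-! ### The bilinear form of the positive dyadic operator -/

namespace DyadicGrid

variable {n : ℕ} {D : DyadicGrid n}

/-- The term `F(Q) H(Q) / |Q|` of the form `∑_Q ⟨f⟩_Q ⟨h⟩_Q |Q|`, for `F = f dx` and
`H = h dx`. -/
noncomputable def formTerm (F H : Measure (Fin n → ℝ)) (Q : DyadicCube n) : ℝ≥0∞ :=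
  F Q.toSet * H Q.toSet / volume Q.toSet

/-- The sum of the terms `F(R) H(R) / |R|` over the cubes `R ⊆ Q` of the grid that are at most `N`
generations below `Q`, defined by recursion on `N`. -/
noncomputable def localForm (D : DyadicGrid n) (F H : Measure (Fin n → ℝ)) :
    ℕ → DyadicCube n → ℝ≥0∞
  | 0, Q => formTerm F H Q
  | N + 1, Q => formTerm F H Q + ∑' R : D.descendants 1 Q, localForm D F H N R.1

/-- The quantity `Φ(s)^α Ψ(s)^β`. Below `α = 1/p` and `β = 1/q'`, so that `α + β > 1`. -/
noncomputable def energy (α β : ℝ) (Φ Ψ : Measure (Fin n → ℝ)) (s : Set (Fin n → ℝ)) : ℝ≥0∞ :=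
  Φ s ^ α * Ψ s ^ β

variable {α β : ℝ} {Φ Ψ F H : Measure (Fin n → ℝ)}

theorem energy_mono (hα : 0 ≤ α) (hβ : 0 ≤ β) {s t : Set (Fin n → ℝ)} (h : s ⊆ t) :
    energy α β Φ Ψ s ≤ energy α β Φ Ψ t :=
  mul_le_mul' (ENNReal.rpow_le_rpow (measure_mono h) hα) (ENNReal.rpow_le_rpow (measure_mono h) hβ)

/-- The power of the energy that is homogeneous of degree one is superadditive, by Hölder's
inequality. -/
theorem tsum_energy_rpow_le (hα : 0 < α) (hβ : 0 < β) {ι : Type*} [Countable ι]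
    {s : ι → Set (Fin n → ℝ)} (hs : ∀ i, MeasurableSet (s i))
    (hd : Pairwise (Function.onFun Disjoint s)) {t : Set (Fin n → ℝ)} (ht : ⋃ i, s i ⊆ t) :
    ∑' i, energy α β Φ Ψ (s i) ^ (1 / (α + β)) ≤ energy α β Φ Ψ t ^ (1 / (α + β)) := by
  have hs0 : 0 < α + β := by positivity
  have key : ∀ s, energy α β Φ Ψ s ^ (1 / (α + β)) =
      Φ s ^ (α / (α + β)) * Ψ s ^ (β / (α + β)) := by
    intro s
    rw [energy, ENNReal.mul_rpow_of_nonneg _ _ (by positivity), ← ENNReal.rpow_mul,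
      ← ENNReal.rpow_mul, mul_one_div, mul_one_div]
  simp only [key]
  let _ : MeasurableSpace ι := ⊤
  rw [← lintegral_count]
  refine (ENNReal.lintegral_mul_norm_pow_le (Measurable.of_discrete).aemeasurable
    (Measurable.of_discrete).aemeasurable (by positivity) (by positivity)
    (by rw [← add_div, div_self hs0.ne'])).trans ?_
  rw [lintegral_count, lintegral_count, ← measure_iUnion hd hs, ← measure_iUnion hd hs]
  gcongr

theorem energy_eq_mul (hαβ : 1 < α + β) (s : Set (Fin n → ℝ)) :
    energy α β Φ Ψ s =
      energy α β Φ Ψ s ^ (1 / (α + β)) * energy α β Φ Ψ s ^ (1 - 1 / (α + β)) := by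
  have h0 : 1 / (α + β) ≤ 1 := by rw [div_le_one (by linarith)]; exact hαβ.le
  rw [← ENNReal.rpow_add_of_nonneg _ _ (by positivity) (by linarith)]
  simp

/-- The factor by which the energies of a disjoint family of subsets of `Q` add up to less than the
energy of `Q`, when each of the subsets carries at most half of one of the masses of `Q`. -/
noncomputable def energyRatio (α β : ℝ) : ℝ≥0 :=
  ((1 / 2) ^ min α β) ^ (1 - 1 / (α + β))

theorem energyRatio_lt_one (hα : 0 < α) (hβ : 0 < β) (hαβ : 1 < α + β) : energyRatio α β < 1 := by
  have h0 : 1 / (α + β) < 1 := by rw [div_lt_one (by linarith)]; exact hαβ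
  refine NNReal.rpow_lt_one (NNReal.rpow_lt_one ?_ (lt_min hα hβ)) (by linarith)
  rw [div_lt_one two_pos]; exact one_lt_two

theorem energy_le_energyRatio_mul (hα : 0 < α) (hβ : 0 < β) (hαβ : 1 < α + β)
    {s t : Set (Fin n → ℝ)} (hst : s ⊆ t) (h : 2 * Φ s ≤ Φ t ∨ 2 * Ψ s ≤ Ψ t) :
    energy α β Φ Ψ s ≤ energyRatio α β * energy α β Φ Ψ t ^ (1 - 1 / (α + β)) *
      energy α β Φ Ψ s ^ (1 / (α + β)) := by
  have h0 : 1 / (α + β) ≤ 1 := by rw [div_le_one (by linarith)]; exact hαβ.le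
  have hhalf_le_one : (1 / 2 : ℝ≥0) ≤ 1 := by rw [div_le_one two_pos]; exact one_le_two
  have hhalf : ∀ {x y : ℝ≥0∞} {γ : ℝ}, 0 < γ → min α β ≤ γ → 2 * x ≤ y →
      x ^ γ ≤ ((1 / 2 : ℝ≥0) ^ min α β : ℝ≥0) * y ^ γ := by
    intro x y γ hγ hγ' hxy
    have hx : x ≤ ((1 / 2 : ℝ≥0) : ℝ≥0∞) * y := by
      rw [ENNReal.coe_div two_ne_zero, ENNReal.coe_one, ENNReal.coe_ofNat, one_div,
        mul_comm, ← div_eq_mul_inv, ENNReal.le_div_iff_mul_le (by simp) (by simp), mul_comm]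
      exact hxy
    refine (ENNReal.rpow_le_rpow hx hγ.le).trans ?_
    rw [ENNReal.mul_rpow_of_nonneg _ _ hγ.le, ← ENNReal.coe_rpow_of_nonneg _ hγ.le]
    exact mul_le_mul_left (ENNReal.coe_le_coe.2
      (NNReal.rpow_le_rpow_of_exponent_ge (half_pos one_pos) hhalf_le_one hγ')) _
  have hle : energy α β Φ Ψ s ≤ ((1 / 2 : ℝ≥0) ^ min α β : ℝ≥0) * energy α β Φ Ψ t := by
    unfold energy
    rcases h with h | h
    · rw [← mul_assoc]
      exact mul_le_mul' (hhalf hα (min_le_left _ _) h)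
        (ENNReal.rpow_le_rpow (measure_mono hst) hβ.le)
    · rw [mul_left_comm]
      exact mul_le_mul' (ENNReal.rpow_le_rpow (measure_mono hst) hα.le)
        (hhalf hβ (min_le_right _ _) h)
  have hle' := ENNReal.rpow_le_rpow hle (z := 1 - 1 / (α + β)) (by linarith)
  rw [ENNReal.mul_rpow_of_nonneg _ _ (by linarith),
    ← ENNReal.coe_rpow_of_nonneg _ (by linarith)] at hle'
  calc energy α β Φ Ψ s = _ := energy_eq_mul hαβ s
    _ ≤ _ := by
      rw [mul_comm]
      exact mul_le_mul_left hle' _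

/-- The constant `2 / (1 - ρ)` of the energy bound for the bilinear form, the solution of
`2 + K ρ = K`. -/
noncomputable def formConst (α β : ℝ) : ℝ≥0 := 2 / (1 - energyRatio α β)

theorem two_mul_add_formConst (hα : 0 < α) (hβ : 0 < β) (hαβ : 1 < α + β) :
    2 + formConst α β * energyRatio α β = formConst α β := by
  have h := energyRatio_lt_one hα hβ hαβ
  have h1 : (1 - energyRatio α β) ≠ 0 := (tsub_pos_of_lt h).ne'
  have h2 : formConst α β * (1 - energyRatio α β) = 2 := div_mul_cancel₀ _ h1
  calc 2 + formConst α β * energyRatio α β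
      = formConst α β * ((1 - energyRatio α β) + energyRatio α β) := by rw [mul_add, h2]
    _ = formConst α β := by rw [tsub_add_cancel_of_le h.le, mul_one]

/-- One step down a chain of cubes: half of the term of `Q` is absorbed by the term of the smaller
cube `R`, because `|R| ≤ |Q| / 2`, and the rest is carried by `Q \ R`. -/
theorem two_mul_formTerm_le (hn : 0 < n) {Q R : DyadicCube n} (hRQ : R.toSet ⊆ Q.toSet)
    (hlt : R.scale < Q.scale) :
    2 * formTerm F H Q ≤ formTerm F H R +
      2 * (F (Q.toSet \ R.toSet) * H Q.toSet / volume Q.toSet +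
        F Q.toSet * H (Q.toSet \ R.toSet) / volume Q.toSet) := by
  set E := Q.toSet \ R.toSet
  have hF : F Q.toSet = F E + F R.toSet := by
    rw [add_comm, ← measure_inter_add_sdiff Q.toSet R.measurableSet_toSet,
      Set.inter_eq_self_of_subset_right hRQ]
  have hH : H Q.toSet = H E + H R.toSet := by
    rw [add_comm, ← measure_inter_add_sdiff Q.toSet R.measurableSet_toSet,
      Set.inter_eq_self_of_subset_right hRQ]
  have h1 : F Q.toSet * H Q.toSet ≤
      F R.toSet * H R.toSet + (F E * H Q.toSet + F Q.toSet * H E) := by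
    calc F Q.toSet * H Q.toSet = F E * H Q.toSet + F R.toSet * (H E + H R.toSet) := by
          rw [← hH, ← add_mul, ← hF]
      _ = F R.toSet * H R.toSet + (F E * H Q.toSet + F R.toSet * H E) := by ring
      _ ≤ _ := by gcongr
  have h2 : 2 * (F R.toSet * H R.toSet / volume Q.toSet) ≤ formTerm F H R := by
    unfold formTerm
    have hvol := DyadicCube.two_mul_volume_le hn hlt
    rw [ENNReal.le_div_iff_mul_le (.inl R.volume_ne_zero) (.inl R.volume_ne_top)]
    calc 2 * (F R.toSet * H R.toSet / volume Q.toSet) * volume R.toSet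
        = F R.toSet * H R.toSet / volume Q.toSet * (2 * volume R.toSet) := by ring
      _ ≤ F R.toSet * H R.toSet / volume Q.toSet * volume Q.toSet := by gcongr
      _ = _ := ENNReal.div_mul_cancel Q.volume_ne_zero Q.volume_ne_top
  calc 2 * formTerm F H Q
      ≤ 2 * ((F R.toSet * H R.toSet + (F E * H Q.toSet + F Q.toSet * H E)) / volume Q.toSet) := by
        unfold formTerm; gcongr
    _ = 2 * (F R.toSet * H R.toSet / volume Q.toSet) +
        2 * (F E * H Q.toSet / volume Q.toSet + F Q.toSet * H E / volume Q.toSet) := by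
        rw [ENNReal.add_div, ENNReal.add_div, mul_add]
    _ ≤ _ := by gcongr

/-- The measure `X` carries the form `∑_Q F(Q) H(Q) / |Q|` on those cubes `Q ⊆ Q₀` that hold more
than half of each of the masses `Φ(Q₀)` and `Ψ(Q₀)`. Two disjoint cubes cannot both be of this
kind. -/
def ChainBound (D : DyadicGrid n) (Φ Ψ F H X : Measure (Fin n → ℝ)) (Q₀ : DyadicCube n) : Prop :=
  ∀ Q ∈ D.cubes, Q.toSet ⊆ Q₀.toSet → Φ Q₀.toSet < 2 * Φ Q.toSet → Ψ Q₀.toSet < 2 * Ψ Q.toSet →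
    ∀ E, MeasurableSet E → E ⊆ Q.toSet →
      F E * H Q.toSet / volume Q.toSet + F Q.toSet * H E / volume Q.toSet ≤ X E

/-- The inductive step: if the energy bound holds for fewer than `N` generations, then below a cube
`Q` of the chain in `Q₀` the form is bounded by `X(Q)` and a fraction of the energy. The additional
`formTerm F H Q` on the left drives the induction along the chain. -/
theorem localForm_add_formTerm_le (hn : 0 < n) (hα : 0 < α) (hβ : 0 < β) (hαβ : 1 < α + β)
    [IsFiniteMeasure Φ] {K : ℝ≥0∞} {X : Measure (Fin n → ℝ)} {Q₀ : DyadicCube n}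
    (hX : D.ChainBound Φ Ψ F H X Q₀) {N : ℕ}
    (ih : ∀ M < N, ∀ Q ∈ D.cubes, D.localForm F H M Q ≤ K * energy α β Φ Ψ Q.toSet) :
    ∀ M ≤ N, ∀ Q ∈ D.cubes, Q.toSet ⊆ Q₀.toSet → Φ Q₀.toSet < 2 * Φ Q.toSet →
      Ψ Q₀.toSet < 2 * Ψ Q.toSet →
      D.localForm F H M Q + formTerm F H Q ≤ 2 * X Q.toSet +
        K * (energyRatio α β * energy α β Φ Ψ Q₀.toSet ^ (1 - 1 / (α + β))) *
          energy α β Φ Ψ Q.toSet ^ (1 / (α + β)) := by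
  classical
  set c := K * (energyRatio α β * energy α β Φ Ψ Q₀.toSet ^ (1 - 1 / (α + β))) with hc
  have hterm : ∀ Q ∈ D.cubes, Q.toSet ⊆ Q₀.toSet → Φ Q₀.toSet < 2 * Φ Q.toSet →
      Ψ Q₀.toSet < 2 * Ψ Q.toSet → 2 * formTerm F H Q ≤ 2 * X Q.toSet := by
    intro Q hQ hQQ₀ hΦ hΨ
    gcongr
    exact le_self_add.trans (hX Q hQ hQQ₀ hΦ hΨ _ Q.measurableSet_toSet subset_rfl)
  intro M
  induction M with
  | zero =>
    intro _ Q hQ hQQ₀ hΦ hΨ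
    rw [localForm, ← two_mul]
    exact (hterm Q hQ hQQ₀ hΦ hΨ).trans le_self_add
  | succ M ihM =>
    intro hM Q hQ hQQ₀ hΦ hΨ
    have hsum : ∑' R : D.descendants 1 Q, c * energy α β Φ Ψ R.1.toSet ^ (1 / (α + β)) ≤
        c * energy α β Φ Ψ Q.toSet ^ (1 / (α + β)) := by
      rw [ENNReal.tsum_mul_left]
      gcongr
      exact tsum_energy_rpow_le hα hβ (fun R => R.1.measurableSet_toSet)
        (pairwise_disjoint_descendants 1 Q) (Set.iUnion_subset fun R => R.2.2.1)
    have hnot : ∀ R : D.descendants 1 Q,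
        ¬(Φ Q₀.toSet < 2 * Φ R.1.toSet ∧ Ψ Q₀.toSet < 2 * Ψ R.1.toSet) →
        D.localForm F H M R.1 ≤ c * energy α β Φ Ψ R.1.toSet ^ (1 / (α + β)) := by
      intro R hR
      refine (ih M hM R.1 R.2.1).trans ?_
      rw [hc, mul_assoc]
      gcongr
      refine energy_le_energyRatio_mul hα hβ hαβ (R.2.2.1.trans hQQ₀) ?_
      rwa [not_and_or, not_lt, not_lt] at hR
    rw [localForm, add_right_comm, ← two_mul]
    by_cases hex : ∃ R : D.descendants 1 Q,
        Φ Q₀.toSet < 2 * Φ R.1.toSet ∧ Ψ Q₀.toSet < 2 * Ψ R.1.toSet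
    -- At most one child `R` of `Q` is in the chain, and its own term is absorbed by the induction
    -- on `M`; the other children fall under `ih`.
    · obtain ⟨R, hRΦ, hRΨ⟩ := hex
      have hRQ : R.1.toSet ⊆ Q.toSet := R.2.2.1
      have hRscale : R.1.scale < Q.scale := by rw [R.2.2.2]; push_cast; omega
      have huniq : ∀ R' : D.descendants 1 Q, R' ≠ R →
          ¬(Φ Q₀.toSet < 2 * Φ R'.1.toSet ∧ Ψ Q₀.toSet < 2 * Ψ R'.1.toSet) := by
        rintro R' hne ⟨h1, -⟩
        have hdisj := pairwise_disjoint_descendants 1 Q hne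
        have h2 : Φ R'.1.toSet + Φ R.1.toSet ≤ Φ Q₀.toSet := by
          rw [← measure_union hdisj R.1.measurableSet_toSet]
          exact measure_mono (Set.union_subset (R'.2.2.1.trans hQQ₀) (hRQ.trans hQQ₀))
        have h3 : Φ Q₀.toSet + Φ Q₀.toSet < 2 * Φ R'.1.toSet + 2 * Φ R.1.toSet :=
          ENNReal.add_lt_add h1 hRΦ
        rw [← mul_add, ← two_mul] at h3
        exact absurd h3 (not_lt.2 (mul_le_mul_right h2 2))
      have hsplit : ∀ f : D.descendants 1 Q → ℝ≥0∞,
          ∑' R', f R' = f R + ∑' R', if R' = R then 0 else f R' := fun f => by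
        convert ENNReal.tsum_eq_add_tsum_ite R
      rw [hsplit] at hsum ⊢
      calc 2 * formTerm F H Q + (D.localForm F H M R.1 +
            ∑' R' : D.descendants 1 Q, if R' = R then 0 else D.localForm F H M R'.1)
          ≤ (formTerm F H R.1 + 2 * X (Q.toSet \ R.1.toSet)) + (D.localForm F H M R.1 +
            ∑' R' : D.descendants 1 Q, if R' = R then 0 else
              c * energy α β Φ Ψ R'.1.toSet ^ (1 / (α + β))) := by
            refine add_le_add ?_ (add_le_add_right (ENNReal.tsum_le_tsum fun R' => ?_) _)
            · refine (two_mul_formTerm_le hn hRQ hRscale).trans ?_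
              gcongr
              exact hX Q hQ hQQ₀ hΦ hΨ _ (Q.measurableSet_toSet.diff R.1.measurableSet_toSet)
                Set.sdiff_subset
            · split_ifs with h
              · exact le_rfl
              · exact hnot R' (huniq R' h)
        _ = (D.localForm F H M R.1 + formTerm F H R.1) + 2 * X (Q.toSet \ R.1.toSet) +
            ∑' R' : D.descendants 1 Q, (if R' = R then 0 else
              c * energy α β Φ Ψ R'.1.toSet ^ (1 / (α + β))) := by ring
        _ ≤ (2 * X R.1.toSet + c * energy α β Φ Ψ R.1.toSet ^ (1 / (α + β))) +
            2 * X (Q.toSet \ R.1.toSet) +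
            ∑' R' : D.descendants 1 Q, (if R' = R then 0 else
              c * energy α β Φ Ψ R'.1.toSet ^ (1 / (α + β))) := by
            refine add_le_add_left (add_le_add_left ?_ _) _
            exact ihM (by omega) R.1 R.2.1 (hRQ.trans hQQ₀) hRΦ hRΨ
        _ = 2 * (X R.1.toSet + X (Q.toSet \ R.1.toSet)) +
            (c * energy α β Φ Ψ R.1.toSet ^ (1 / (α + β)) +
            ∑' R' : D.descendants 1 Q, (if R' = R then 0 else
              c * energy α β Φ Ψ R'.1.toSet ^ (1 / (α + β)))) := by ring
        _ ≤ _ := by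
            have hXQ : X R.1.toSet + X (Q.toSet \ R.1.toSet) = X Q.toSet := by
              rw [← measure_inter_add_sdiff Q.toSet R.1.measurableSet_toSet,
                Set.inter_eq_self_of_subset_right hRQ]
            rw [hXQ]
            exact add_le_add_right hsum _
    · rw [not_exists] at hex
      refine add_le_add (hterm Q hQ hQQ₀ hΦ hΨ) (le_trans ?_ hsum)
      exact ENNReal.tsum_le_tsum fun R => hnot R (hex R)

/-- The energy bound for the bilinear form over the cubes below a given one. -/
theorem localForm_le (hn : 0 < n) (hα : 0 < α) (hβ : 0 < β) (hαβ : 1 < α + β)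
    [IsFiniteMeasure Φ] [IsFiniteMeasure Ψ] {K : ℝ≥0∞}
    (hterm : ∀ Q ∈ D.cubes, formTerm F H Q ≤ K * energy α β Φ Ψ Q.toSet)
    (hX : ∀ Q₀ ∈ D.cubes, energy α β Φ Ψ Q₀.toSet ≠ 0 → ∃ X : Measure (Fin n → ℝ),
      X Q₀.toSet ≤ K * energy α β Φ Ψ Q₀.toSet ∧ D.ChainBound Φ Ψ F H X Q₀) :
    ∀ N, ∀ Q ∈ D.cubes,
      D.localForm F H N Q ≤ formConst α β * K * energy α β Φ Ψ Q.toSet := by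
  intro N
  induction N using Nat.strong_induction_on with
  | _ N ih =>
    intro Q hQ
    by_cases h0 : energy α β Φ Ψ Q.toSet = 0
    -- If the energy vanishes, then `Q` is not in its own chain, but all terms are zero.
    · have hz : ∀ R ∈ D.cubes, R.toSet ⊆ Q.toSet → energy α β Φ Ψ R.toSet = 0 := fun R _ hRQ =>
        le_antisymm ((energy_mono hα.le hβ.le hRQ).trans h0.le) zero_le
      have ht : formTerm F H Q = 0 := by
        refine le_antisymm ((hterm Q hQ).trans ?_) zero_le
        rw [h0, mul_zero]
      rw [h0, mul_zero]
      cases N with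
      | zero => rw [localForm, ht]
      | succ M =>
        rw [localForm, ht, zero_add]
        refine (ENNReal.tsum_eq_zero.2 fun R => ?_).le
        refine le_antisymm ((ih M M.lt_succ_self R.1 R.2.1).trans ?_) zero_le
        rw [hz R.1 R.2.1 R.2.2.1, mul_zero]
    · obtain ⟨X, hXQ, hXc⟩ := hX Q hQ h0
      have hlt : ∀ (μ : Measure (Fin n → ℝ)) [IsFiniteMeasure μ], μ Q.toSet ≠ 0 →
          μ Q.toSet < 2 * μ Q.toSet := fun μ _ h => by
        rw [two_mul]
        exact ENNReal.lt_add_right (measure_ne_top _ _) h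
      have hΦ : Φ Q.toSet ≠ 0 := fun h => h0 (by
        rw [energy, h, ENNReal.zero_rpow_of_pos hα, zero_mul])
      have hΨ : Ψ Q.toSet ≠ 0 := fun h => h0 (by
        rw [energy, h, ENNReal.zero_rpow_of_pos hβ, mul_zero])
      have h1 := localForm_add_formTerm_le hn hα hβ hαβ hXc ih N le_rfl Q hQ subset_rfl
        (hlt Φ hΦ) (hlt Ψ hΨ)
      have hconst : (formConst α β : ℝ≥0∞) =
          2 + formConst α β * energyRatio α β := by
        exact_mod_cast (two_mul_add_formConst hα hβ hαβ).symm
      calc D.localForm F H N Q ≤ _ := le_self_add.trans h1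
        _ ≤ 2 * (K * energy α β Φ Ψ Q.toSet) + formConst α β * K *
            (energyRatio α β * energy α β Φ Ψ Q.toSet ^ (1 - 1 / (α + β))) *
            energy α β Φ Ψ Q.toSet ^ (1 / (α + β)) := by gcongr
        _ = 2 * (K * energy α β Φ Ψ Q.toSet) + formConst α β * K * energyRatio α β *
            (energy α β Φ Ψ Q.toSet ^ (1 / (α + β)) *
              energy α β Φ Ψ Q.toSet ^ (1 - 1 / (α + β))) := by ring
        _ = (2 + formConst α β * energyRatio α β) * K * energy α β Φ Ψ Q.toSet := by
            rw [← energy_eq_mul hαβ]; ring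
        _ = _ := by rw [← hconst]

/-- The average of the measure `F` over the cube `Q`. -/
noncomputable def avg (F : Measure (Fin n → ℝ)) (Q : DyadicCube n) : ℝ≥0∞ :=
  F Q.toSet / volume Q.toSet

/-- The local form as an integral of the truncated positive operator against `H`. -/
theorem setLIntegral_sum_avg (hn : 0 < n) (N : ℕ) : ∀ Q ∈ D.cubes,
    ∫⁻ x in Q.toSet, ∑ j ∈ Finset.Icc (Q.scale - N) Q.scale, avg F (D.cubeAt j x) ∂H =
      D.localForm F H N Q := by
  have hconst : ∀ Q ∈ D.cubes, ∫⁻ x in Q.toSet, avg F (D.cubeAt Q.scale x) ∂H =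
      formTerm F H Q := by
    intro Q hQ
    rw [setLIntegral_congr_fun (g := fun _ => avg F Q) Q.measurableSet_toSet
      fun x hx => by simp only [cubeAt_eq hQ rfl hx], setLIntegral_const, avg, formTerm,
      ENNReal.mul_div_right_comm]
  induction N with
  | zero =>
    intro Q hQ
    simp [localForm, hconst Q hQ]
  | succ N ih =>
    intro Q hQ
    have hIcc : Finset.Icc (Q.scale - ((N + 1 : ℕ) : ℤ)) Q.scale =
        insert Q.scale (Finset.Icc (Q.scale - 1 - N) (Q.scale - 1)) := by
      ext j; simp only [Finset.mem_Icc, Finset.mem_insert]; push_cast; omega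
    have hnot : Q.scale ∉ Finset.Icc (Q.scale - 1 - N) (Q.scale - 1) := by simp
    simp_rw [hIcc, Finset.sum_insert hnot]
    rw [lintegral_add_left (measurable_comp_cubeAt _ _), hconst Q hQ, localForm]
    congr 1
    nth_rewrite 1 [← iUnion_descendants hn 1 hQ]
    rw [lintegral_iUnion (fun R => R.1.measurableSet_toSet) (pairwise_disjoint_descendants 1 Q)]
    refine tsum_congr fun R => ?_
    rw [← ih R.1 R.2.1, R.2.2.2]
    simp

/-- The positive dyadic operator `∑_{Q ∋ x, 2^{-N} ≤ ℓ(Q) ≤ 2^N} F(Q) / |Q|`. -/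
noncomputable def posTrunc (D : DyadicGrid n) (F : Measure (Fin n → ℝ)) (N : ℕ)
    (x : Fin n → ℝ) : ℝ≥0∞ :=
  ∑ j ∈ Finset.Icc (-(N : ℤ)) N, avg F (D.cubeAt j x)

theorem measurable_posTrunc (N : ℕ) : Measurable (D.posTrunc F N) :=
  Finset.measurable_sum _ fun _ _ => measurable_comp_cubeAt _ _

/-- The energy bound for the form over all cubes of the grid with side length between `2 ^ (-N)` and
`2 ^ N`, by summing the bounds for the cubes of side length `2 ^ N`. -/
theorem lintegral_posTrunc_le (hn : 0 < n) (hα : 0 < α) (hβ : 0 < β) (hαβ : 1 < α + β)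
    [IsFiniteMeasure Φ] [IsFiniteMeasure Ψ] {K : ℝ≥0∞}
    (hterm : ∀ Q ∈ D.cubes, formTerm F H Q ≤ K * energy α β Φ Ψ Q.toSet)
    (hX : ∀ Q₀ ∈ D.cubes, energy α β Φ Ψ Q₀.toSet ≠ 0 → ∃ X : Measure (Fin n → ℝ),
      X Q₀.toSet ≤ K * energy α β Φ Ψ Q₀.toSet ∧ D.ChainBound Φ Ψ F H X Q₀) (N : ℕ) :
    ∫⁻ x, D.posTrunc F N x ∂H ≤ formConst α β * K * (Φ Set.univ ^ α * Ψ Set.univ ^ β) := by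
  have h0 : 1 / (α + β) ≤ 1 := by rw [div_le_one (by linarith)]; exact hαβ.le
  change _ ≤ _ * energy α β Φ Ψ Set.univ
  rw [← setLIntegral_univ, ← D.iUnion_cubesOfScale N,
    lintegral_iUnion (fun R => R.1.measurableSet_toSet) (pairwise_disjoint_cubesOfScale _),
    D.iUnion_cubesOfScale N]
  calc ∑' R : D.cubesOfScale N, ∫⁻ x in R.1.toSet, D.posTrunc F N x ∂H
      = ∑' R : D.cubesOfScale N, D.localForm F H (2 * N) R.1 := by
        refine tsum_congr fun R => ?_
        rw [← setLIntegral_sum_avg hn _ _ R.2.1, R.2.2]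
        have : (N : ℤ) - ((2 * N : ℕ) : ℤ) = -N := by push_cast; ring
        rw [this]
        rfl
    _ ≤ ∑' R : D.cubesOfScale N, formConst α β * K * (energy α β Φ Ψ R.1.toSet ^ (1 / (α + β)) *
        energy α β Φ Ψ Set.univ ^ (1 - 1 / (α + β))) := by
        refine ENNReal.tsum_le_tsum fun R => (localForm_le hn hα hβ hαβ hterm hX _ _ R.2.1).trans ?_
        gcongr
        conv_lhs => rw [energy_eq_mul hαβ]
        exact mul_le_mul_right (ENNReal.rpow_le_rpow
          (energy_mono hα.le hβ.le (Set.subset_univ _)) (sub_nonneg.2 h0)) _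
    _ ≤ _ := by
        rw [ENNReal.tsum_mul_left, ENNReal.tsum_mul_right]
        conv_rhs => rw [energy_eq_mul hαβ Set.univ]
        gcongr
        exact tsum_energy_rpow_le hα hβ (fun R => R.1.measurableSet_toSet)
          (pairwise_disjoint_cubesOfScale _) (Set.subset_univ _)

end DyadicGrid

/-! ### Consequences of the maximal function bounds -/

namespace DyadicGrid

variable {𝕜 : Type*} [RCLike 𝕜] {n : ℕ} {D : DyadicGrid n}

variable (D) in
theorem measurable_maximal (f : (Fin n → ℝ) → 𝕜) : Measurable (D.maximal f) := by
  unfold maximal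
  refine Measurable.biSup _ D.countable_cubes fun Q _ => ?_
  have : (fun x => ⨆ _ : x ∈ Q.toSet, (∫⁻ y in Q.toSet, ‖f y‖ₑ) / volume Q.toSet) =
      Q.toSet.indicator fun _ => (∫⁻ y in Q.toSet, ‖f y‖ₑ) / volume Q.toSet := by
    ext x
    by_cases hx : x ∈ Q.toSet <;> simp [hx]
  rw [this]
  exact measurable_const.indicator Q.measurableSet_toSet

/-- The measure `k^r w dx`, whose total mass is `‖k‖_{L^r(w)}^r`. -/
noncomputable def massMeasure (r : ℝ) (w k : (Fin n → ℝ) → ℝ≥0∞) : Measure (Fin n → ℝ) :=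
  volume.withDensity fun x => k x ^ r * w x

theorem avg_le_maximal {f : (Fin n → ℝ) → 𝕜} {Q Q₀ : DyadicCube n} (hQ : Q ∈ D.cubes)
    (h : Q.toSet ⊆ Q₀.toSet) {x : Fin n → ℝ} (hx : x ∈ Q.toSet) :
    avg (volume.withDensity fun y => ‖f y‖ₑ) Q ≤ D.maximal (Q₀.toSet.indicator f) x := by
  refine le_trans (le_of_eq ?_) (le_iSup₂_of_le Q hQ (le_iSup_of_le hx le_rfl))
  rw [avg, withDensity_apply _ Q.measurableSet_toSet]
  congr 1
  refine setLIntegral_congr_fun Q.measurableSet_toSet fun y hy => ?_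
  simp only [Set.indicator_of_mem (h hy)]

theorem mul_avg_le_withDensity {f : (Fin n → ℝ) → 𝕜} {k : (Fin n → ℝ) → ℝ≥0∞}
    (hk : AEMeasurable k) {Q Q₀ : DyadicCube n} (hQ : Q ∈ D.cubes)
    (h : Q.toSet ⊆ Q₀.toSet) {E : Set (Fin n → ℝ)} (hE : MeasurableSet E) (hEQ : E ⊆ Q.toSet) :
    volume.withDensity k E * (volume.withDensity fun y => ‖f y‖ₑ) Q.toSet / volume Q.toSet ≤
      (volume.withDensity fun x => k x * D.maximal (Q₀.toSet.indicator f) x) E := by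
  rw [mul_div_assoc, withDensity_apply k hE, withDensity_apply _ hE,
    ← lintegral_mul_const'' _ hk.restrict]
  exact setLIntegral_mono_ae' hE (ae_of_all _ fun x hx =>
    mul_le_mul_right (avg_le_maximal hQ h (hEQ hx)) _)

/-- Pointwise form of the duality between `L^a(x)` and `L^b(x^{1-b})`. If `x = ∞`, then the
hypothesis that `k ^ a * x` is finite forces `k = 0`. -/
theorem mul_le_rpow_mul_rpow {a b : ℝ} (hab : a.HolderConjugate b) {x k : ℝ≥0∞} (m : ℝ≥0∞)
    (hx : x ≠ 0) (hk : k ^ a * x ≠ ∞) :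
    k * m ≤ (k ^ a * x) ^ (1 / a) * (m ^ b * x ^ (1 - b)) ^ (1 / b) := by
  have ha := hab.pos
  have hb := hab.symm.pos
  by_cases hk0 : k = 0
  · simp [hk0]
  have hxt : x ≠ ∞ := by
    rintro rfl
    exact hk (ENNReal.mul_top (by simp [hk0, ha.not_gt]))
  rw [ENNReal.mul_rpow_of_nonneg _ _ (by positivity),
    ENNReal.mul_rpow_of_nonneg _ _ (by positivity), ← ENNReal.rpow_mul,
    ← ENNReal.rpow_mul, ← ENNReal.rpow_mul, mul_one_div_cancel ha.ne',
    mul_one_div_cancel hb.ne', ENNReal.rpow_one, ENNReal.rpow_one]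
  have hexp : 1 / a + (1 - b) * (1 / b) = 0 := by
    have := hab.inv_add_inv_eq_one
    field_simp at this ⊢
    linarith
  have : x ^ (1 / a) * x ^ ((1 - b) * (1 / b)) = 1 := by
    rw [← ENNReal.rpow_add _ _ hx hxt, hexp, ENNReal.rpow_zero]
  refine le_of_eq ?_
  calc k * m = k * m * (x ^ (1 / a) * x ^ ((1 - b) * (1 / b))) := by rw [this, mul_one]
    _ = _ := by ring

/-- A maximal function bound, localized to a cube of the grid and put in dual form by Hölder's
inequality. -/
theorem lintegral_mul_maximal_le {a b r : ℝ} (hab : a.HolderConjugate b) (hr : 0 < r)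
    {x w : (Fin n → ℝ) → ℝ≥0∞} {B : ℝ≥0}
    (hM : D.MaximalBound 𝕜 r b w (fun y => x y ^ (1 - b)) B) (hxm : AEMeasurable x)
    (hx : ∀ᵐ y, x y ≠ 0) {k : (Fin n → ℝ) → ℝ≥0∞} (hk : AEMeasurable k)
    [IsFiniteMeasure (massMeasure a x k)] {g : (Fin n → ℝ) → 𝕜} (hg : AEStronglyMeasurable g)
    [IsFiniteMeasure (massMeasure r w fun y => ‖g y‖ₑ)] (Q₀ : DyadicCube n) :
    ∫⁻ y in Q₀.toSet, k y * D.maximal (Q₀.toSet.indicator g) y ≤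
      B * energy (1 / a) (1 / r) (massMeasure a x k) (massMeasure r w fun y => ‖g y‖ₑ)
        Q₀.toSet := by
  have ha := hab.pos
  have hb := hab.symm.pos
  have hQ := Q₀.measurableSet_toSet
  set m := D.maximal (Q₀.toSet.indicator g)
  have hmm : Measurable m := D.measurable_maximal _
  have hfin : ∀ᵐ y, k y ^ a * x y ≠ ∞ := by
    have h1 : ∫⁻ y, k y ^ a * x y ≠ ∞ := by
      have := measure_ne_top (massMeasure a x k) Set.univ
      rwa [massMeasure, withDensity_apply _ MeasurableSet.univ, setLIntegral_univ] at this
    filter_upwards [ae_lt_top' ((hk.pow_const _).mul hxm) h1] with y hy using hy.ne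
  have hnorm : weightedNorm r w (fun y => ‖Q₀.toSet.indicator g y‖ₑ) =
      massMeasure r w (fun y => ‖g y‖ₑ) Q₀.toSet ^ (1 / r) := by
    rw [weightedNorm, massMeasure, withDensity_apply _ hQ, ← lintegral_indicator hQ]
    congr 2
    ext y
    by_cases hy : y ∈ Q₀.toSet
    · simp [hy]
    · simp [hy, hr]
  have hmem : MemWeighted r w (Q₀.toSet.indicator g) := by
    refine ⟨hg.indicator hQ, ?_⟩
    rw [hnorm]
    exact ENNReal.rpow_lt_top_of_nonneg (by positivity) (measure_ne_top _ _)
  calc ∫⁻ y in Q₀.toSet, k y * m y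
      ≤ ∫⁻ y in Q₀.toSet, ((fun y => (k y ^ a * x y) ^ (1 / a)) *
          fun y => (m y ^ b * x y ^ (1 - b)) ^ (1 / b)) y := by
        refine lintegral_mono_ae (ae_restrict_of_ae ?_)
        filter_upwards [hx, hfin] with y hy hy'
        exact mul_le_rpow_mul_rpow hab _ hy hy'
    _ ≤ (∫⁻ y in Q₀.toSet, k y ^ a * x y) ^ (1 / a) *
        (∫⁻ y in Q₀.toSet, m y ^ b * x y ^ (1 - b)) ^ (1 / b) := by
        refine (ENNReal.lintegral_mul_le_Lp_mul_Lq _ hab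
          (((hk.pow_const _).mul hxm).pow_const _).restrict
          (((hmm.aemeasurable.pow_const _).mul (hxm.pow_const _)).pow_const _).restrict).trans ?_
        simp_rw [← ENNReal.rpow_mul, one_div_mul_cancel ha.ne', one_div_mul_cancel hb.ne',
          ENNReal.rpow_one]
        exact le_rfl
    _ ≤ (∫⁻ y in Q₀.toSet, k y ^ a * x y) ^ (1 / a) *
        weightedNorm b (fun y => x y ^ (1 - b)) m := by
        rw [weightedNorm]
        gcongr
        exact Measure.restrict_le_self
    _ ≤ (∫⁻ y in Q₀.toSet, k y ^ a * x y) ^ (1 / a) *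
        (B * massMeasure r w (fun y => ‖g y‖ₑ) Q₀.toSet ^ (1 / r)) := by
        rw [← hnorm]
        gcongr
        exact hM _ hmem
    _ = _ := by
        simp only [energy, massMeasure, withDensity_apply _ hQ]
        ring

section

variable {p q : ℝ} {u v h : (Fin n → ℝ) → ℝ≥0∞} {f : (Fin n → ℝ) → 𝕜} {A B : ℝ≥0}

theorem enorm_ofReal_toReal {x : ℝ≥0∞} (hx : x ≠ ∞) : ‖((x.toReal : ℝ) : 𝕜)‖ₑ = x := by
  rw [← ofReal_norm, RCLike.norm_ofReal, abs_of_nonneg ENNReal.toReal_nonneg,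
    ENNReal.ofReal_toReal hx]

/-- The dual maximal function bound, tested on a nonnegative function `h`. -/
theorem lintegral_mul_maximal_toReal_le (hp : 1 < p) (hq : 1 < q)
    (hB : D.MaximalBound 𝕜 q.conjExponent p.conjExponent
      (fun x => u x ^ (1 - q.conjExponent)) (fun x => v x ^ (1 - p.conjExponent)) B)
    (hv : AEMeasurable v) (hv0 : ∀ᵐ x, 0 < v x) (hf : AEStronglyMeasurable f)
    [IsFiniteMeasure (massMeasure p v fun y => ‖f y‖ₑ)]
    (hh : AEMeasurable h) (hht : ∀ x, h x ≠ ∞)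
    [hfin : IsFiniteMeasure (massMeasure q.conjExponent (fun x => u x ^ (1 - q.conjExponent)) h)]
    (Q₀ : DyadicCube n) :
    ∫⁻ y in Q₀.toSet, ‖f y‖ₑ *
        D.maximal (Q₀.toSet.indicator fun x => (((h x).toReal : ℝ) : 𝕜)) y ≤
      B * energy (1 / p) (1 / q.conjExponent) (massMeasure p v fun y => ‖f y‖ₑ)
        (massMeasure q.conjExponent (fun x => u x ^ (1 - q.conjExponent)) h) Q₀.toSet := by
  have henorm : (fun x => ‖(((h x).toReal : ℝ) : 𝕜)‖ₑ) = h :=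
    funext fun x => enorm_ofReal_toReal (hht x)
  have hmeas : AEStronglyMeasurable (fun x => (((h x).toReal : ℝ) : 𝕜)) volume :=
    (RCLike.measurable_ofReal.comp_aemeasurable hh.ennreal_toReal).aestronglyMeasurable
  have hfin' : IsFiniteMeasure (massMeasure q.conjExponent (fun x => u x ^ (1 - q.conjExponent))
      fun x => ‖(((h x).toReal : ℝ) : 𝕜)‖ₑ) := by rwa [henorm]
  have := lintegral_mul_maximal_le (Real.HolderConjugate.conjExponent hp)
    (Real.HolderConjugate.conjExponent hq).symm.pos hB hv (hv0.mono fun _ h => h.ne')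
    (k := fun y => ‖f y‖ₑ) hf.enorm hmeas Q₀
  rwa [henorm] at this

/-- The estimate for a single cube: the dual maximal function is at least `⟨h⟩_Q` on `Q`. -/
theorem formTerm_le_of_maximalBound (hp : 1 < p) (hq : 1 < q)
    (hB : D.MaximalBound 𝕜 q.conjExponent p.conjExponent
      (fun x => u x ^ (1 - q.conjExponent)) (fun x => v x ^ (1 - p.conjExponent)) B)
    (hv : AEMeasurable v) (hv0 : ∀ᵐ x, 0 < v x) (hf : AEStronglyMeasurable f)
    [IsFiniteMeasure (massMeasure p v fun y => ‖f y‖ₑ)]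
    (hh : AEMeasurable h) (hht : ∀ x, h x ≠ ∞)
    [IsFiniteMeasure (massMeasure q.conjExponent (fun x => u x ^ (1 - q.conjExponent)) h)]
    {Q : DyadicCube n} (hQ : Q ∈ D.cubes) :
    formTerm (volume.withDensity fun y => ‖f y‖ₑ) (volume.withDensity h) Q ≤
      B * energy (1 / p) (1 / q.conjExponent) (massMeasure p v fun y => ‖f y‖ₑ)
        (massMeasure q.conjExponent (fun x => u x ^ (1 - q.conjExponent)) h) Q.toSet := by
  have henorm : (fun x => ‖(((h x).toReal : ℝ) : 𝕜)‖ₑ) = h :=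
    funext fun x => enorm_ofReal_toReal (hht x)
  have := mul_avg_le_withDensity (D := D) (f := fun x => (((h x).toReal : ℝ) : 𝕜)) hf.enorm hQ
    subset_rfl Q.measurableSet_toSet subset_rfl
  rw [henorm] at this
  exact this.trans ((withDensity_apply _ Q.measurableSet_toSet).trans_le
    (lintegral_mul_maximal_toReal_le hp hq hB hv hv0 hf hh hht Q))

theorem one_lt_one_div_add_one_div_conjExponent (hp : 1 < p) (hpq : p < q) :
    1 < 1 / p + 1 / q.conjExponent := by
  have h1 := (Real.HolderConjugate.conjExponent (hp.trans hpq)).inv_add_inv_eq_one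
  have h2 : q⁻¹ < p⁻¹ := by
    rw [inv_lt_inv₀ (by linarith) (by linarith)]; exact hpq
  rw [one_div, one_div]
  linarith

/-- The bilinear bound for the positive dyadic operator under both maximal function bounds. The
form is carried by the density `f M(h 1_{Q₀}) + h M(f 1_{Q₀})`. -/
theorem lintegral_mul_posTrunc_le (hn : 0 < n) (hp : 1 < p) (hpq : p < q)
    (hA : D.MaximalBound 𝕜 p q v u A)
    (hB : D.MaximalBound 𝕜 q.conjExponent p.conjExponent
      (fun x => u x ^ (1 - q.conjExponent)) (fun x => v x ^ (1 - p.conjExponent)) B)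
    (hu : AEMeasurable u) (hut : ∀ᵐ x, u x < ∞)
    (hv : AEMeasurable v) (hv0 : ∀ᵐ x, 0 < v x) (hf : AEStronglyMeasurable f)
    [IsFiniteMeasure (massMeasure p v fun y => ‖f y‖ₑ)]
    (hh : AEMeasurable h) (hht : ∀ x, h x ≠ ∞)
    [IsFiniteMeasure (massMeasure q.conjExponent (fun x => u x ^ (1 - q.conjExponent)) h)]
    (N : ℕ) :
    ∫⁻ x, h x * D.posTrunc (volume.withDensity fun y => ‖f y‖ₑ) N x ≤
      formConst (1 / p) (1 / q.conjExponent) * (A + B) *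
        ((massMeasure p v fun y => ‖f y‖ₑ) Set.univ ^ (1 / p) *
        (massMeasure q.conjExponent (fun x => u x ^ (1 - q.conjExponent)) h) Set.univ ^
          (1 / q.conjExponent)) := by
  have hq := hp.trans hpq
  have hqq := Real.HolderConjugate.conjExponent hq
  have henorm : (fun x => ‖(((h x).toReal : ℝ) : 𝕜)‖ₑ) = h :=
    funext fun x => enorm_ofReal_toReal (hht x)
  set g : (Fin n → ℝ) → 𝕜 := fun x => (((h x).toReal : ℝ) : 𝕜)
  -- The weight `u` is dual to `u ^ (1 - q')` with respect to the exponent `q`.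
  have hA' : D.MaximalBound 𝕜 p q v (fun x => (u x ^ (1 - q.conjExponent)) ^ (1 - q)) A := by
    have : (fun x => (u x ^ (1 - q.conjExponent)) ^ (1 - q)) = u := by
      ext x
      have h1 : (1 - q.conjExponent) * (1 - q) = 1 := by
        rw [Real.conjExponent]
        have : q - 1 ≠ 0 := by linarith
        field_simp
        ring
      rw [← ENNReal.rpow_mul, h1, ENNReal.rpow_one]
    rwa [this]
  have hu0 : ∀ᵐ x, u x ^ (1 - q.conjExponent) ≠ 0 := by
    filter_upwards [hut] with x hx h0
    rw [ENNReal.rpow_eq_zero_iff] at h0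
    rcases h0 with ⟨-, h1⟩ | ⟨h1, -⟩
    · linarith [hqq.symm.lt]
    · exact hx.ne h1
  refine (lintegral_withDensity_eq_lintegral_mul₀ hh
    (measurable_posTrunc N).aemeasurable).ge.trans ?_
  refine lintegral_posTrunc_le hn (one_div_pos.2 (by linarith)) (one_div_pos.2 hqq.symm.pos)
    (one_lt_one_div_add_one_div_conjExponent hp hpq) (fun Q hQ => ?_) (fun Q₀ hQ₀ _ => ?_) N
  · refine (formTerm_le_of_maximalBound hp hq hB hv hv0 hf hh hht hQ).trans ?_
    gcongr
    exact le_add_self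
  · refine ⟨(volume.withDensity fun y => ‖f y‖ₑ * D.maximal (Q₀.toSet.indicator g) y) +
      volume.withDensity fun y => h y * D.maximal (Q₀.toSet.indicator f) y, ?_, ?_⟩
    · rw [Measure.add_apply, withDensity_apply _ Q₀.measurableSet_toSet,
        withDensity_apply _ Q₀.measurableSet_toSet, add_comm, add_mul]
      refine add_le_add ?_ (lintegral_mul_maximal_toReal_le hp hq hB hv hv0 hf hh hht Q₀)
      refine (lintegral_mul_maximal_le hqq.symm (by linarith) hA' (hu.pow_const _) hu0 hh hf
        Q₀).trans_eq ?_
      rw [energy, energy, mul_comm (_ ^ _)]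
    · intro Q hQ hQQ₀ _ _ E hE hEQ
      rw [Measure.add_apply]
      refine add_le_add ?_ ?_
      · have := mul_avg_le_withDensity (D := D) (f := g) hf.enorm hQ hQQ₀ hE hEQ
        rwa [henorm] at this
      · rw [mul_comm]
        exact mul_avg_le_withDensity hh hQ hQQ₀ hE hEQ

/-- The bilinear bound for the positive dyadic operator and `h = u 1_E`, under the dual maximal
function bound alone. Then the `L^{q'}(u^{1-q'})` mass of `h` is `h dx` itself, so that on the chain
cubes, which hold more than half of it, the averages of `f` are controlled by the estimate
for a single cube. -/
theorem lintegral_mul_posTrunc_le_of_eq_or_eq_zero (hn : 0 < n) (hp : 1 < p) (hpq : p < q)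
    (hB : D.MaximalBound 𝕜 q.conjExponent p.conjExponent
      (fun x => u x ^ (1 - q.conjExponent)) (fun x => v x ^ (1 - p.conjExponent)) B)
    (hv : AEMeasurable v) (hv0 : ∀ᵐ x, 0 < v x) (hf : AEStronglyMeasurable f)
    [IsFiniteMeasure (massMeasure p v fun y => ‖f y‖ₑ)]
    (hh : AEMeasurable h) (hht : ∀ x, h x ≠ ∞) (hint : ∫⁻ x, h x ≠ ∞)
    (hhu : ∀ x, h x = 0 ∨ h x = u x)
    (N : ℕ) :
    ∫⁻ x, h x * D.posTrunc (volume.withDensity fun y => ‖f y‖ₑ) N x ≤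
      formConst (1 / p) (1 / q.conjExponent) * (3 * B) *
        ((massMeasure p v fun y => ‖f y‖ₑ) Set.univ ^ (1 / p) *
        (∫⁻ x, h x) ^ (1 / q.conjExponent)) := by
  have hq := hp.trans hpq
  have hqq := Real.HolderConjugate.conjExponent hq
  have henorm : (fun x => ‖(((h x).toReal : ℝ) : 𝕜)‖ₑ) = h :=
    funext fun x => enorm_ofReal_toReal (hht x)
  set g : (Fin n → ℝ) → 𝕜 := fun x => (((h x).toReal : ℝ) : 𝕜)
  set H := volume.withDensity h with hH
  set Φ := massMeasure p v fun y => ‖f y‖ₑ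
  have hmass : massMeasure q.conjExponent (fun x => u x ^ (1 - q.conjExponent)) h = H := by
    rw [massMeasure, hH]
    congr 1
    ext x
    by_cases h0 : h x = 0
    · simp [h0, hqq.symm.pos]
    · rcases hhu x with h1 | h1
      · exact absurd h1 h0
      · rw [← h1, ← ENNReal.rpow_add _ _ h0 (hht x)]
        simp
  have hHfin : IsFiniteMeasure H := isFiniteMeasure_withDensity hint
  have hfin : IsFiniteMeasure (massMeasure q.conjExponent
    (fun x => u x ^ (1 - q.conjExponent)) h) := by rwa [hmass]
  have hHuniv : H Set.univ = ∫⁻ x, h x := by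
    rw [hH, withDensity_apply _ MeasurableSet.univ, setLIntegral_univ]
  have hterm : ∀ Q ∈ D.cubes, formTerm (volume.withDensity fun y => ‖f y‖ₑ) H Q ≤
      B * energy (1 / p) (1 / q.conjExponent) Φ H Q.toSet := by
    intro Q hQ
    have := formTerm_le_of_maximalBound hp hq hB hv hv0 hf hh hht hQ
    rwa [hmass] at this
  have hα : 0 < 1 / p := one_div_pos.2 (by linarith)
  have hβ : 0 < 1 / q.conjExponent := one_div_pos.2 hqq.symm.pos
  rw [← hHuniv]
  refine (lintegral_withDensity_eq_lintegral_mul₀ hh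
    (measurable_posTrunc N).aemeasurable).ge.trans ?_
  refine lintegral_posTrunc_le hn hα hβ
    (one_lt_one_div_add_one_div_conjExponent hp hpq) (fun Q hQ => ?_) (fun Q₀ hQ₀ hne => ?_) N
  · refine (hterm Q hQ).trans ?_
    gcongr
    exact le_mul_of_one_le_left' (by norm_num)
  · set e := energy (1 / p) (1 / q.conjExponent) Φ H Q₀.toSet with he
    have hH0 : H Q₀.toSet ≠ 0 := fun h0 => hne (by
      rw [he, energy, h0, ENNReal.zero_rpow_of_pos hβ, mul_zero])
    have hHt : H Q₀.toSet ≠ ∞ := measure_ne_top _ _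
    refine ⟨(volume.withDensity fun y => ‖f y‖ₑ * D.maximal (Q₀.toSet.indicator g) y) +
      (2 * B * e / H Q₀.toSet) • H, ?_, ?_⟩
    · rw [Measure.add_apply, Measure.smul_apply, smul_eq_mul, ENNReal.div_mul_cancel hH0 hHt,
        withDensity_apply _ Q₀.measurableSet_toSet]
      have := lintegral_mul_maximal_toReal_le hp hq hB hv hv0 hf hh hht Q₀
      rw [hmass] at this
      calc _ ≤ B * e + 2 * B * e := by gcongr
        _ = 3 * B * e := by ring
    · intro Q hQ hQQ₀ _ hΨ E hE hEQ
      rw [Measure.add_apply, Measure.smul_apply, smul_eq_mul]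
      refine add_le_add ?_ ?_
      · have := mul_avg_le_withDensity (D := D) (f := g) hf.enorm hQ hQQ₀ hE hEQ
        rwa [henorm] at this
      · rw [ENNReal.mul_div_right_comm]
        refine mul_le_mul_left ?_ _
        have hHQ0 : H Q.toSet ≠ 0 := fun h0 => by simp [h0] at hΨ
        have h1 := (hterm Q hQ).trans (mul_le_mul_right (energy_mono hα.le hβ.le hQQ₀) (B : ℝ≥0∞))
        rw [formTerm, ENNReal.mul_div_right_comm,
          ← ENNReal.le_div_iff_mul_le (.inl hHQ0) (.inl (measure_ne_top _ _))] at h1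
        refine h1.trans ?_
        rw [ENNReal.div_le_iff_le_mul (.inl hHQ0) (.inl (measure_ne_top _ _))]
        calc B * e = B * e * (H Q₀.toSet / H Q₀.toSet) := by
              rw [ENNReal.div_self hH0 hHt, mul_one]
          _ ≤ B * e * (2 * H Q.toSet / H Q₀.toSet) := by gcongr
          _ = 2 * B * e / H Q₀.toSet * H Q.toSet := by
              simp only [div_eq_mul_inv]
              ring

end

end DyadicGrid

/-! ### The positive dyadic operator -/

namespace DyadicGrid

variable {𝕜 : Type*} [RCLike 𝕜] {n : ℕ} {D : DyadicGrid n}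

/-- The positive dyadic operator `∑_{Q ∋ x} F(Q) / |Q|`, with the sum over all cubes of the grid. -/
noncomputable def posOp (D : DyadicGrid n) (F : Measure (Fin n → ℝ)) (x : Fin n → ℝ) : ℝ≥0∞ :=
  ⨆ N, D.posTrunc F N x

theorem monotone_posTrunc (F : Measure (Fin n → ℝ)) (x : Fin n → ℝ) :
    Monotone fun N => D.posTrunc F N x := by
  intro M N h
  have h' : (M : ℤ) ≤ N := by exact_mod_cast h
  exact Finset.sum_le_sum_of_subset (Finset.Icc_subset_Icc (neg_le_neg h') h')

theorem tendsto_posTrunc (F : Measure (Fin n → ℝ)) (x : Fin n → ℝ) :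
    Tendsto (fun N => D.posTrunc F N x) atTop (𝓝 (D.posOp F x)) :=
  tendsto_atTop_iSup (monotone_posTrunc F x)

theorem mul_rpow_le_of_mul_le_mul_rpow {q q' : ℝ} (hq : q.HolderConjugate q') {t I c : ℝ≥0∞}
    (hI : I ≠ ∞) (h : t * I ≤ c * I ^ (1 / q')) : t * I ^ (1 / q) ≤ c := by
  have h1 := hq.pos
  have h2 := hq.symm.pos
  rcases eq_or_ne I 0 with rfl | h0
  · rw [ENNReal.zero_rpow_of_pos (by positivity), mul_zero]
    exact zero_le
  · have hsplit : I = I ^ (1 / q) * I ^ (1 / q') := by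
      rw [← ENNReal.rpow_add _ _ h0 hI, one_div, one_div, hq.inv_add_inv_eq_one, ENNReal.rpow_one]
    have hne : I ^ (1 / q') ≠ 0 := by
      rw [Ne, ENNReal.rpow_eq_zero_iff_of_pos (by positivity)]; exact h0
    have hnt : I ^ (1 / q') ≠ ∞ := ENNReal.rpow_ne_top_of_nonneg (by positivity) hI
    rw [← ENNReal.mul_le_mul_iff_left hne hnt, mul_assoc, ← hsplit]
    exact h

variable {p q : ℝ} {u v : (Fin n → ℝ) → ℝ≥0∞} {f : (Fin n → ℝ) → 𝕜} {A B : ℝ≥0}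

theorem massMeasure_univ (r : ℝ) (w k : (Fin n → ℝ) → ℝ≥0∞) :
    massMeasure r w k Set.univ = ∫⁻ x, k x ^ r * w x := by
  rw [massMeasure, withDensity_apply _ MeasurableSet.univ, setLIntegral_univ]

theorem massMeasure_univ_rpow (r : ℝ) (w k : (Fin n → ℝ) → ℝ≥0∞) :
    massMeasure r w k Set.univ ^ (1 / r) = weightedNorm r w k := by
  rw [massMeasure_univ, weightedNorm]

theorem isFiniteMeasure_massMeasure {r : ℝ} (hr : 0 < r) {w k : (Fin n → ℝ) → ℝ≥0∞}
    (h : weightedNorm r w k < ∞) : IsFiniteMeasure (massMeasure r w k) := by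
  refine ⟨?_⟩
  rw [massMeasure_univ]
  by_contra hc
  rw [not_lt, top_le_iff] at hc
  rw [weightedNorm, hc, ENNReal.top_rpow_of_pos (by positivity)] at h
  exact lt_irrefl _ h

/-- A bounded region on which the weight `u` is bounded. These regions exhaust `{u < ∞}`. -/
def truncSet (u : (Fin n → ℝ) → ℝ≥0∞) (N : ℕ) : Set (Fin n → ℝ) :=
  {x | u x ≤ N} ∩ Metric.ball 0 N

theorem nullMeasurableSet_truncSet (hu : AEMeasurable u) (N : ℕ) :
    NullMeasurableSet (truncSet u N) :=
  (hu.nullMeasurable measurableSet_Iic).inter measurableSet_ball.nullMeasurableSet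

theorem eventually_mem_truncSet {x : Fin n → ℝ} (hx : u x < ∞) :
    ∀ᶠ N in atTop, x ∈ truncSet u N := by
  obtain ⟨M, hM⟩ := ENNReal.exists_nat_gt hx.ne
  obtain ⟨M', hM'⟩ := exists_nat_gt ‖x‖
  filter_upwards [eventually_ge_atTop M, eventually_ge_atTop M'] with N h1 h2
  refine ⟨hM.le.trans (by exact_mod_cast h1), ?_⟩
  rw [mem_ball_zero_iff]
  exact hM'.trans_le (by exact_mod_cast h2)

theorem lintegral_ne_top_of_truncSet {N : ℕ} {k : (Fin n → ℝ) → ℝ≥0∞} {c : ℝ≥0∞} (hc : c ≠ ∞)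
    (h0 : ∀ x ∉ truncSet u N, k x = 0) (hk : ∀ x ∈ truncSet u N, k x ≤ c) :
    ∫⁻ x, k x ≠ ∞ := by
  refine ne_top_of_le_ne_top (b := ∫⁻ x, (Metric.ball 0 (N : ℝ)).indicator (fun _ => c) x) ?_
    (lintegral_mono fun x => ?_)
  · rw [lintegral_indicator_const measurableSet_ball]
    exact ENNReal.mul_ne_top hc measure_ball_lt_top.ne
  · by_cases hx : x ∈ truncSet u N
    · rw [Set.indicator_of_mem hx.2]
      exact hk x hx
    · rw [h0 x hx]
      exact zero_le

/-- The strong-type bound for the positive dyadic operator. The bilinear bound is tested on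
`h = g^{q-1} u`, where `g` is a truncation of the operator with `∫ g^q u < ∞`. -/
theorem weightedNorm_posOp_le (hn : 0 < n) (hp : 1 < p) (hpq : p < q)
    (hA : D.MaximalBound 𝕜 p q v u A)
    (hB : D.MaximalBound 𝕜 q.conjExponent p.conjExponent
      (fun x => u x ^ (1 - q.conjExponent)) (fun x => v x ^ (1 - p.conjExponent)) B)
    (huv : IsWeightPair u v) (hf : MemWeighted p v f) :
    weightedNorm q u (D.posOp (volume.withDensity fun y => ‖f y‖ₑ)) ≤
      formConst (1 / p) (1 / q.conjExponent) * (A + B) * weightedNorm p v (fun x => ‖f x‖ₑ) := by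
  have hq := hp.trans hpq
  have hqq := Real.HolderConjugate.conjExponent hq
  have := isFiniteMeasure_massMeasure (by linarith) hf.2
  set F := volume.withDensity fun y => ‖f y‖ₑ
  set c := formConst (1 / p) (1 / q.conjExponent) * (A + B) * weightedNorm p v (fun x => ‖f x‖ₑ)
  set g : ℕ → (Fin n → ℝ) → ℝ≥0∞ := fun N => (truncSet u N).indicator
    fun x => min (D.posTrunc F N x) N with hg
  have hgm : ∀ N, AEMeasurable (g N) := fun N =>
    ((measurable_posTrunc N).min measurable_const).aemeasurable.indicator₀
      (nullMeasurableSet_truncSet huv.measurable_u N)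
  have hgN : ∀ N x, g N x ≤ N := fun N x => by
    rw [hg]
    exact Set.indicator_le' (fun _ _ => min_le_right _ _) (fun _ _ => zero_le) x
  have hgT : ∀ N x, g N x ≤ D.posTrunc F N x := fun N x => by
    rw [hg]
    exact Set.indicator_le' (fun _ _ => min_le_left _ _) (fun _ _ => zero_le) x
  have hI : ∀ N, ∫⁻ x, g N x ^ q * u x ≠ ∞ := fun N => by
    refine lintegral_ne_top_of_truncSet (u := u) (N := N) (c := (N : ℝ≥0∞) ^ q * N)
      (ENNReal.mul_ne_top (ENNReal.rpow_ne_top_of_nonneg (by linarith) (by simp)) (by simp)) ?_ ?_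
    · intro x hx
      simp only [hg, Set.indicator_of_notMem hx]
      rw [ENNReal.zero_rpow_of_pos (by linarith), zero_mul]
    · intro x hx
      exact mul_le_mul' (ENNReal.rpow_le_rpow (hgN N x) (by linarith)) hx.1
  have key : ∀ N, (∫⁻ x, g N x ^ q * u x) ^ (1 / q) ≤ c := by
    intro N
    set h : (Fin n → ℝ) → ℝ≥0∞ := fun x => g N x ^ (q - 1) * u x with hh
    have hhm : AEMeasurable h := ((hgm N).pow_const _).mul huv.measurable_u
    have hh0 : ∀ x ∉ truncSet u N, h x = 0 := fun x hx => by
      simp only [hh, hg, Set.indicator_of_notMem hx]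
      rw [ENNReal.zero_rpow_of_pos (by linarith), zero_mul]
    have hht : ∀ x, h x ≠ ∞ := fun x => by
      by_cases hx : x ∈ truncSet u N
      · exact ENNReal.mul_ne_top (ENNReal.rpow_ne_top_of_nonneg (by linarith)
          (ne_top_of_le_ne_top (by simp) (hgN N x))) (ne_top_of_le_ne_top (by simp) hx.1)
      · rw [hh0 x hx]; exact ENNReal.zero_ne_top
    have hpow : ∀ᵐ x, h x ^ q.conjExponent * u x ^ (1 - q.conjExponent) = g N x ^ q * u x := by
      filter_upwards [huv.u_lt_top] with x hx
      rw [hh]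
      have hqne : q - 1 ≠ 0 := by linarith
      have h1 : (q - 1) * q.conjExponent = q := by
        rw [Real.conjExponent]; field_simp
      rw [ENNReal.mul_rpow_of_nonneg _ _ hqq.symm.nonneg, ← ENNReal.rpow_mul, h1, mul_assoc]
      rcases eq_or_ne (u x) 0 with h0 | h0
      · rw [h0, ENNReal.zero_rpow_of_pos hqq.symm.pos, zero_mul]
      · rw [← ENNReal.rpow_add _ _ h0 hx.ne, add_sub_cancel, ENNReal.rpow_one]
    have hmass : massMeasure q.conjExponent (fun x => u x ^ (1 - q.conjExponent)) h Set.univ =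
        ∫⁻ x, g N x ^ q * u x := by
      rw [massMeasure_univ]
      exact lintegral_congr_ae hpow
    have hfin : IsFiniteMeasure
        (massMeasure q.conjExponent (fun x => u x ^ (1 - q.conjExponent)) h) :=
      ⟨by rw [hmass]; exact (hI N).lt_top⟩
    have h1 := lintegral_mul_posTrunc_le hn hp hpq hA hB huv.measurable_u huv.u_lt_top
      huv.measurable_v huv.v_pos hf.1 hhm hht N
    rw [hmass, massMeasure_univ_rpow, ← mul_assoc] at h1
    have h2 := mul_rpow_le_of_mul_le_mul_rpow hqq (t := 1) (c := c) (hI N) (by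
      rw [one_mul]
      refine le_trans (lintegral_mono fun x => ?_) h1
      calc g N x ^ q * u x = g N x ^ (q - 1) * u x * g N x := by
            nth_rewrite 1 [show q = (q - 1) + 1 by ring]
            rw [ENNReal.rpow_add_of_nonneg _ _ (by linarith) zero_le_one, ENNReal.rpow_one]
            ring
        _ ≤ _ := by
          gcongr
          exact hgT N x)
    rwa [one_mul] at h2
  have hlim : ∀ᵐ x, Tendsto (fun N => g N x ^ q * u x) atTop (𝓝 (D.posOp F x ^ q * u x)) := by
    filter_upwards [huv.u_lt_top] with x hx
    have h1 : Tendsto (fun N : ℕ => min (D.posTrunc F N x) N) atTop (𝓝 (D.posOp F x)) := by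
      have := (tendsto_posTrunc F x (D := D)).min ENNReal.tendsto_nat_nhds_top
      rwa [min_top_right] at this
    have h2 : Tendsto (fun N => g N x) atTop (𝓝 (D.posOp F x)) := by
      refine h1.congr' ?_
      filter_upwards [eventually_mem_truncSet hx] with N hN
      simp only [hg, Set.indicator_of_mem hN]
    exact ENNReal.Tendsto.mul_const ((ENNReal.continuous_rpow_const.tendsto _).comp h2)
      (.inr hx.ne)
  rw [weightedNorm, one_div, ENNReal.rpow_inv_le_iff (by linarith)]
  calc ∫⁻ x, D.posOp F x ^ q * u x = ∫⁻ x, liminf (fun N => g N x ^ q * u x) atTop := by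
        refine lintegral_congr_ae ?_
        filter_upwards [hlim] with x hx
        exact hx.liminf_eq.symm
    _ ≤ liminf (fun N => ∫⁻ x, g N x ^ q * u x) atTop :=
        lintegral_liminf_le' fun N => ((hgm N).pow_const _).mul huv.measurable_u
    _ ≤ c ^ q := by
        refine liminf_le_of_le ?_ fun b hb => ?_
        · isBoundedDefault
        · obtain ⟨N, hN⟩ := hb.exists
          refine hN.trans ?_
          rw [← ENNReal.rpow_inv_le_iff (by linarith), ← one_div]
          exact key N

/-- The weak-type bound for the positive dyadic operator. The bilinear bound is tested on the
restrictions of `u` to the level sets of the operator. -/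
theorem weightedWeakNorm_posOp_le (hn : 0 < n) (hp : 1 < p) (hpq : p < q)
    (hB : D.MaximalBound 𝕜 q.conjExponent p.conjExponent
      (fun x => u x ^ (1 - q.conjExponent)) (fun x => v x ^ (1 - p.conjExponent)) B)
    (huv : IsWeightPair u v) (hf : MemWeighted p v f) :
    weightedWeakNorm q u (D.posOp (volume.withDensity fun y => ‖f y‖ₑ)) ≤
      formConst (1 / p) (1 / q.conjExponent) * (3 * B) * weightedNorm p v (fun x => ‖f x‖ₑ) := by
  have hq := hp.trans hpq
  have hqq := Real.HolderConjugate.conjExponent hq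
  have := isFiniteMeasure_massMeasure (by linarith) hf.2
  set F := volume.withDensity fun y => ‖f y‖ₑ
  set c := formConst (1 / p) (1 / q.conjExponent) * (3 * B) * weightedNorm p v (fun x => ‖f x‖ₑ)
  refine iSup_le fun t => ?_
  rcases eq_or_ne t 0 with rfl | ht
  · simp
  have ht0 : (t : ℝ≥0∞) ≠ 0 := by exact_mod_cast ht
  set E : ℕ → Set (Fin n → ℝ) := fun N => truncSet u N ∩ {x | (t : ℝ≥0∞) < D.posTrunc F N x}
  have hEm : ∀ N, NullMeasurableSet (E N) := fun N =>
    (nullMeasurableSet_truncSet huv.measurable_u N).inter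
      (measurable_posTrunc N measurableSet_Ioi).nullMeasurableSet
  have hm : ∀ N, AEMeasurable ((E N).indicator u) := fun N => huv.measurable_u.indicator₀ (hEm N)
  have h0 : ∀ N, ∀ x ∉ truncSet u N, (E N).indicator u x = 0 := fun N x hx =>
    Set.indicator_of_notMem (fun h => hx h.1) _
  have hle : ∀ N, ∀ x ∈ truncSet u N, (E N).indicator u x ≤ N := fun N x hx =>
    (Set.indicator_le_self _ _ _).trans hx.1
  have hI : ∀ N, ∫⁻ x, (E N).indicator u x ≠ ∞ := fun N =>
    lintegral_ne_top_of_truncSet (ENNReal.natCast_ne_top N) (h0 N) (hle N)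
  have key : ∀ N, t * (∫⁻ x, (E N).indicator u x) ^ (1 / q) ≤ c := by
    intro N
    have hht : ∀ x, (E N).indicator u x ≠ ∞ := fun x => by
      by_cases hx : x ∈ truncSet u N
      · exact ne_top_of_le_ne_top (ENNReal.natCast_ne_top N) (hle N x hx)
      · rw [h0 N x hx]; exact ENNReal.zero_ne_top
    have h1 := lintegral_mul_posTrunc_le_of_eq_or_eq_zero hn hp hpq hB huv.measurable_v
      huv.v_pos hf.1 (hm N) hht (hI N) (fun x => Set.indicator_eq_zero_or_self _ _ _) N
    rw [massMeasure_univ_rpow, ← mul_assoc] at h1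
    refine mul_rpow_le_of_mul_le_mul_rpow hqq (hI N) (le_trans ?_ h1)
    rw [← lintegral_const_mul' _ _ ENNReal.coe_ne_top]
    refine lintegral_mono fun x => ?_
    by_cases hx : x ∈ E N
    · rw [mul_comm]
      exact mul_le_mul_right hx.2.le _
    · simp [hx]
  set S := {x | (t : ℝ≥0∞) < D.posOp F x}
  have hSm : MeasurableSet S :=
    (Measurable.iSup fun N => measurable_posTrunc N) measurableSet_Ioi
  have hlim : ∀ᵐ x, Tendsto (fun N => (E N).indicator u x) atTop (𝓝 (S.indicator u x)) := by
    filter_upwards [huv.u_lt_top] with x hx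
    refine tendsto_const_nhds.congr' ?_
    by_cases hxS : x ∈ S
    · filter_upwards [eventually_mem_truncSet hx,
        (tendsto_posTrunc F x (D := D)).eventually_const_lt hxS] with N h1 h2
      have hxE : x ∈ E N := ⟨h1, h2⟩
      rw [Set.indicator_of_mem hxS, Set.indicator_of_mem hxE]
    · refine Eventually.of_forall fun N => ?_
      have hxE : x ∉ E N := fun h => hxS (h.2.trans_le (le_iSup (fun N => D.posTrunc F N x) N))
      simp only [Set.indicator_of_notMem hxS, Set.indicator_of_notMem hxE]
  have hbound : ∫⁻ x in S, u x ≤ (c / t) ^ q := by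
    calc ∫⁻ x in S, u x = ∫⁻ x, liminf (fun N => (E N).indicator u x) atTop := by
          rw [← lintegral_indicator hSm]
          refine lintegral_congr_ae ?_
          filter_upwards [hlim] with x hx
          exact hx.liminf_eq.symm
      _ ≤ liminf (fun N => ∫⁻ x, (E N).indicator u x) atTop := lintegral_liminf_le' hm
      _ ≤ (c / t) ^ q := by
          refine liminf_le_of_le ?_ fun b hb => ?_
          · isBoundedDefault
          · obtain ⟨N, hN⟩ := hb.exists
            refine hN.trans ?_
            rw [← ENNReal.rpow_inv_le_iff (by linarith), ← one_div,
              ENNReal.le_div_iff_mul_le (.inl ht0) (.inl ENNReal.coe_ne_top), mul_comm]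
            exact key N
  rw [← ENNReal.rpow_inv_le_iff (by linarith), ← one_div,
    ENNReal.le_div_iff_mul_le (.inl ht0) (.inl ENNReal.coe_ne_top), mul_comm] at hbound
  exact hbound

end DyadicGrid

/-! ### Haar shifts -/

namespace DyadicGrid

variable {n : ℕ} {D : DyadicGrid n}

theorem sum_avg_le_posOp (F : Measure (Fin n → ℝ)) (x : Fin n → ℝ) (s : Finset ℤ) :
    ∑ j ∈ s, avg F (D.cubeAt j x) ≤ D.posOp F x := by
  refine le_iSup_of_le (s.sup Int.natAbs) (Finset.sum_le_sum_of_subset fun j hj => ?_)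
  have := Finset.le_sup (f := Int.natAbs) hj
  rw [Finset.mem_Icc]
  omega

/-- If the positive dyadic operator is of weak type at `F`, then it is finite almost everywhere
where the weight does not vanish. -/
theorem posOp_lt_top {F : Measure (Fin n → ℝ)} {q : ℝ} (hq : 0 < q)
    {u : (Fin n → ℝ) → ℝ≥0∞} (hu : AEMeasurable u)
    (h : weightedWeakNorm q u (D.posOp F) ≠ ∞) : ∀ᵐ x, u x ≠ 0 → D.posOp F x < ∞ := by
  have hm : Measurable (D.posOp F) := Measurable.iSup fun N => measurable_posTrunc N
  have hS : MeasurableSet {x | D.posOp F x = ∞} := hm (measurableSet_singleton ∞)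
  have h0 : ∫⁻ x in {x | D.posOp F x = ∞}, u x = 0 := by
    by_contra hne
    have hne' : (∫⁻ x in {x | D.posOp F x = ∞}, u x) ^ (1 / q) ≠ 0 := by
      rwa [Ne, ENNReal.rpow_eq_zero_iff_of_pos (by positivity)]
    obtain ⟨N, hN⟩ := ENNReal.exists_nat_mul_gt hne' h
    refine absurd hN (not_lt.2 ?_)
    refine le_trans ?_ (le_iSup _ (N : ℝ≥0))
    rw [ENNReal.coe_natCast]
    refine mul_le_mul_right (ENNReal.rpow_le_rpow (lintegral_mono_set fun x hx => ?_)
      (by positivity)) _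
    rw [Set.mem_ofPred_eq] at hx ⊢
    rw [hx]
    exact ENNReal.natCast_lt_top N
  rw [lintegral_eq_zero_iff' hu.restrict, Filter.EventuallyEq, ae_restrict_iff' hS] at h0
  filter_upwards [h0] with x hx hux
  rw [lt_top_iff_ne_top]
  exact fun h => hux (hx h)

open Classical in
/-- The integers `j` with `ε ≤ 2 ^ j ≤ ε'`; there are finitely many if `0 < ε`, and the
value is empty if there are infinitely many. -/
noncomputable def scales (ε ε' : ℝ) : Finset ℤ :=
  if h : {j : ℤ | ε ≤ (2 : ℝ) ^ j ∧ (2 : ℝ) ^ j ≤ ε'}.Finite then h.toFinset else ∅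

theorem mem_scales {ε ε' : ℝ} (hε : 0 < ε) {j : ℤ} :
    j ∈ scales ε ε' ↔ ε ≤ (2 : ℝ) ^ j ∧ (2 : ℝ) ^ j ≤ ε' := by
  have h : {j : ℤ | ε ≤ (2 : ℝ) ^ j ∧ (2 : ℝ) ^ j ≤ ε'}.Finite := by
    rcases le_or_gt ε' 0 with h0 | h0
    · convert Set.finite_empty
      rw [Set.eq_empty_iff_forall_notMem]
      intro j hj
      exact absurd (hj.2.trans h0) (not_le.2 (zpow_pos two_pos j))
    · obtain ⟨a, ha, -⟩ := exists_mem_Ico_zpow hε (one_lt_two)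
      obtain ⟨b, -, hb⟩ := exists_mem_Ico_zpow h0 (one_lt_two)
      refine (Set.finite_Icc a (b + 1)).subset fun j hj => ⟨?_, ?_⟩
      · exact (zpow_le_zpow_iff_right₀ one_lt_two).1 (ha.trans hj.1)
      · exact (zpow_le_zpow_iff_right₀ one_lt_two).1 (hj.2.trans hb.le)
  simp [scales, h]

theorem tendsto_scales :
    Tendsto (fun e : ℝ × ℝ => scales e.1 e.2) (𝓝[>] 0 ×ˢ atTop) atTop := by
  rw [tendsto_atTop]
  intro s
  have h : ∀ j ∈ s, ∀ᶠ e : ℝ × ℝ in 𝓝[>] 0 ×ˢ atTop, j ∈ scales e.1 e.2 := by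
    intro j _
    filter_upwards [tendsto_fst.eventually (Ioc_mem_nhdsGT (zpow_pos two_pos j : (0 : ℝ) < 2 ^ j)),
      tendsto_snd.eventually (eventually_ge_atTop ((2 : ℝ) ^ j))] with e h1 h2
    exact (mem_scales h1.1).2 ⟨h1.2, h2⟩
  exact (Finset.eventually_all s).2 h

end DyadicGrid

namespace HaarShift

open DyadicGrid

variable {𝕜 : Type*} [RCLike 𝕜] {n : ℕ} {D : DyadicGrid n} {m k : ℕ}

/-- The term `S_Q f` of a Haar shift. -/
noncomputable def piece (S : HaarShift 𝕜 D m k) (Q : DyadicCube n) (f : (Fin n → ℝ) → 𝕜)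
    (x : Fin n → ℝ) : 𝕜 :=
  D.shiftPiece m k S.a S.b Q f x

theorem piece_eq_zero (S : HaarShift 𝕜 D m k) {Q : DyadicCube n} (hQ : Q ∈ D.cubes)
    (f : (Fin n → ℝ) → 𝕜) {x : Fin n → ℝ} (hx : x ∉ Q.toSet) : S.piece Q f x = 0 := by
  unfold piece shiftPiece
  refine finsum_mem_eq_zero_of_forall_eq_zero fun Q' hQ' =>
    finsum_mem_eq_zero_of_forall_eq_zero fun Q'' hQ'' => ?_
  rw [(S.haar_b Q hQ Q' hQ' Q'' hQ'').eq_zero_of_notMem x fun h => hx (hQ''.2.1 h), mul_zero]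

theorem enorm_coeff_mul_le (S : HaarShift 𝕜 D m k) {Q Q' Q'' : DyadicCube n} (hQ : Q ∈ D.cubes)
    (hQ' : Q' ∈ D.descendants m Q) (hQ'' : Q'' ∈ D.descendants k Q) (f : (Fin n → ℝ) → 𝕜)
    (x : Fin n → ℝ) :
    ‖(∫ y, f y * starRingEnd 𝕜 (S.a Q' Q'' y)) / ((volume.real Q.toSet : ℝ) : 𝕜) *
        S.b Q' Q'' x‖ₑ ≤
      (volume.withDensity fun y => ‖f y‖ₑ) Q'.toSet / volume Q.toSet := by
  have ha := S.haar_a Q hQ Q' hQ' Q'' hQ''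
  have hle : ∀ z : 𝕜, ‖z‖ ≤ 1 → ‖z‖ₑ ≤ 1 := fun z hz => by
    rw [← ofReal_norm]
    exact ENNReal.ofReal_le_one.2 hz
  have hb := hle _ ((S.haar_b Q hQ Q' hQ' Q'' hQ'').norm_le_one x)
  have hvol : ‖((volume.real Q.toSet : ℝ) : 𝕜)‖ₑ = volume Q.toSet :=
    enorm_ofReal_toReal Q.volume_ne_top
  have hvol0 : ((volume.real Q.toSet : ℝ) : 𝕜) ≠ 0 := by
    rw [← enorm_ne_zero, hvol]
    exact Q.volume_ne_zero
  have hint : ‖∫ y, f y * starRingEnd 𝕜 (S.a Q' Q'' y)‖ₑ ≤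
      (volume.withDensity fun y => ‖f y‖ₑ) Q'.toSet := by
    rw [withDensity_apply _ Q'.measurableSet_toSet, ← lintegral_indicator Q'.measurableSet_toSet]
    refine (enorm_integral_le_lintegral_enorm _).trans (lintegral_mono fun y => ?_)
    by_cases hy : y ∈ Q'.toSet
    · rw [Set.indicator_of_mem hy, enorm_mul]
      exact mul_le_of_le_one_right' (hle _ (by rw [RCLike.norm_conj]; exact ha.norm_le_one y))
    · rw [ha.eq_zero_of_notMem y hy]
      simp
  rw [enorm_mul, div_eq_mul_inv, enorm_mul, enorm_inv hvol0, hvol, div_eq_mul_inv]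
  calc _ ≤ (volume.withDensity fun y => ‖f y‖ₑ) Q'.toSet * (volume Q.toSet)⁻¹ * 1 := by gcongr
    _ = _ := mul_one _

/-- The pointwise bound `|S_Q f| ≤ ⟨|f|⟩_Q`, with no dependence on the complexity: at a given point
only one of the cubes `Q''` contributes, and the cubes `Q'` are disjoint. -/
theorem enorm_piece_le (S : HaarShift 𝕜 D m k) {Q : DyadicCube n} (hQ : Q ∈ D.cubes)
    (f : (Fin n → ℝ) → 𝕜) (x : Fin n → ℝ) :
    ‖S.piece Q f x‖ₑ ≤ avg (volume.withDensity fun y => ‖f y‖ₑ) Q := by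
  classical
  set F := volume.withDensity fun y => ‖f y‖ₑ
  have hinner : ∀ Q' ∈ D.descendants m Q, ‖∑ᶠ Q'' ∈ D.descendants k Q,
      (∫ y, f y * starRingEnd 𝕜 (S.a Q' Q'' y)) / ((volume.real Q.toSet : ℝ) : 𝕜) *
        S.b Q' Q'' x‖ₑ ≤ F Q'.toSet / volume Q.toSet := by
    intro Q' hQ'
    rw [finsum_eq_single _ (D.cubeAt (Q.scale - k) x)]
    · by_cases hR : D.cubeAt (Q.scale - k) x ∈ D.descendants k Q
      · rw [finsum_eq_if, if_pos hR]
        exact S.enorm_coeff_mul_le hQ hQ' hR f x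
      · rw [finsum_eq_if, if_neg hR]
        simp
    · intro Q'' hne
      rw [finsum_eq_if]
      split_ifs with hQ''
      · rw [(S.haar_b Q hQ Q' hQ' Q'' hQ'').eq_zero_of_notMem x, mul_zero]
        exact fun hx => hne (cubeAt_eq hQ''.1 hQ''.2.2 hx).symm
      · rfl
  set g : DyadicCube n → 𝕜 := fun Q' => ∑ᶠ Q'' ∈ D.descendants k Q,
      (∫ y, f y * starRingEnd 𝕜 (S.a Q' Q'' y)) / ((volume.real Q.toSet : ℝ) : 𝕜) *
        S.b Q' Q'' x
  change ‖∑ᶠ Q' ∈ D.descendants m Q, g Q'‖ₑ ≤ _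
  by_cases hfin : (D.descendants m Q ∩ Function.support g).Finite
  · rw [finsum_mem_eq_sum g hfin]
    have hmem : ∀ Q' ∈ hfin.toFinset, Q' ∈ D.descendants m Q := fun Q' h =>
      ((Set.Finite.mem_toFinset hfin).1 h).1
    calc ‖∑ Q' ∈ hfin.toFinset, g Q'‖ₑ ≤ ∑ Q' ∈ hfin.toFinset, ‖g Q'‖ₑ := enorm_sum_le _ _
      _ ≤ ∑ Q' ∈ hfin.toFinset, F Q'.toSet / volume Q.toSet :=
        Finset.sum_le_sum fun Q' h => hinner Q' (hmem Q' h)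
      _ = F (⋃ Q' ∈ hfin.toFinset, Q'.toSet) / volume Q.toSet := by
        rw [measure_biUnion_finset _ fun Q' _ => Q'.measurableSet_toSet]
        · simp only [div_eq_mul_inv, Finset.sum_mul]
        · intro Q₁ h₁ Q₂ h₂ hne
          have h₁' := hmem Q₁ h₁
          have h₂' := hmem Q₂ h₂
          exact disjoint_of_scale_eq h₁'.1 h₂'.1 (h₁'.2.2.trans h₂'.2.2.symm) hne
      _ ≤ _ := by
        unfold avg
        gcongr
        exact Set.iUnion₂_subset fun Q' h => (hmem Q' h).2.1
  · rw [finsum_mem_eq_zero_of_infinite hfin]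
    simp

theorem trunc_eq_sum (S : HaarShift 𝕜 D m k) {ε ε' : ℝ} (hε : 0 < ε) (f : (Fin n → ℝ) → 𝕜)
    (x : Fin n → ℝ) :
    S.trunc ε ε' f x = ∑ j ∈ scales ε ε', S.piece (D.cubeAt j x) f x := by
  classical
  rw [← Finset.sum_image (f := fun Q => S.piece Q f x) (g := fun j => D.cubeAt j x)
    (fun i _ j _ h => by simpa using congrArg DyadicCube.scale h)]
  refine finsum_mem_eq_sum_of_inter_support_eq _ ?_
  ext Q
  simp only [Set.mem_inter_iff, Set.mem_ofPred_eq, Function.mem_support, Finset.coe_image,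
    Set.mem_image, Finset.mem_coe, mem_scales hε, and_congr_left_iff]
  intro hne
  constructor
  · rintro ⟨hQ, h1, h2⟩
    refine ⟨Q.scale, ⟨h1, h2⟩, cubeAt_eq hQ rfl ?_⟩
    by_contra hx
    exact hne (S.piece_eq_zero hQ f hx)
  · rintro ⟨j, ⟨h1, h2⟩, rfl⟩
    refine ⟨D.cubeAt_mem j x, ?_, ?_⟩ <;> rwa [DyadicCube.side, scale_cubeAt]

theorem sum_enorm_piece_le (S : HaarShift 𝕜 D m k) (f : (Fin n → ℝ) → 𝕜) (x : Fin n → ℝ)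
    (s : Finset ℤ) :
    ∑ j ∈ s, ‖S.piece (D.cubeAt j x) f x‖ₑ ≤ D.posOp (volume.withDensity fun y => ‖f y‖ₑ) x :=
  (Finset.sum_le_sum fun j _ => S.enorm_piece_le (D.cubeAt_mem j x) f x).trans
    (sum_avg_le_posOp _ _ _)

theorem maxTrunc_le_posOp (S : HaarShift 𝕜 D m k) (f : (Fin n → ℝ) → 𝕜) (x : Fin n → ℝ) :
    S.maxTrunc f x ≤ D.posOp (volume.withDensity fun y => ‖f y‖ₑ) x := by
  refine iSup_le fun ε => iSup_le fun ε' => iSup_le fun hε => iSup_le fun _ => ?_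
  rw [S.trunc_eq_sum hε]
  exact (enorm_sum_le _ _).trans (S.sum_enorm_piece_le f x _)

/-- The sum of the series `∑_{Q ∋ x} S_Q f(x)` over all scales, with value zero where the series is
not summable; this happens only where the positive dyadic operator is infinite. -/
noncomputable def value (S : HaarShift 𝕜 D m k) (f : (Fin n → ℝ) → 𝕜) (x : Fin n → ℝ) : 𝕜 :=
  ∑' j : ℤ, S.piece (D.cubeAt j x) f x

theorem enorm_value_le_posOp (S : HaarShift 𝕜 D m k) (f : (Fin n → ℝ) → 𝕜) (x : Fin n → ℝ) :
    ‖S.value f x‖ₑ ≤ D.posOp (volume.withDensity fun y => ‖f y‖ₑ) x := by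
  by_cases h : Summable fun j : ℤ => S.piece (D.cubeAt j x) f x
  · refine le_of_tendsto h.hasSum.enorm (Eventually.of_forall fun s => ?_)
    exact (enorm_sum_le _ _).trans (S.sum_enorm_piece_le f x s)
  · rw [value, tsum_eq_zero_of_not_summable h]
    simp

theorem tendsto_trunc_value (S : HaarShift 𝕜 D m k) {f : (Fin n → ℝ) → 𝕜} {x : Fin n → ℝ}
    (h : D.posOp (volume.withDensity fun y => ‖f y‖ₑ) x < ∞) :
    Tendsto (fun e : ℝ × ℝ => S.trunc e.1 e.2 f x) (𝓝[>] 0 ×ˢ atTop) (𝓝 (S.value f x)) := by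
  have hsum : Summable fun j : ℤ => S.piece (D.cubeAt j x) f x := by
    refine Summable.of_nnnorm (ENNReal.tsum_coe_ne_top_iff_summable.1 ?_)
    refine ne_top_of_le_ne_top h.ne ?_
    rw [ENNReal.tsum_eq_iSup_sum]
    exact iSup_le fun s => S.sum_enorm_piece_le f x s
  refine (hsum.hasSum.comp tendsto_scales).congr' ?_
  filter_upwards [tendsto_fst.eventually (self_mem_nhdsWithin (s := Set.Ioi (0 : ℝ)) (a := 0))]
    with e he
  exact (S.trunc_eq_sum he f x).symm

theorem trunc_congr_ae (S : HaarShift 𝕜 D m k) {f g : (Fin n → ℝ) → 𝕜} (h : f =ᵐ[volume] g)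
    (ε ε' : ℝ) : S.trunc ε ε' f = S.trunc ε ε' g := by
  have hint : ∀ a : (Fin n → ℝ) → 𝕜,
      ∫ y, f y * starRingEnd 𝕜 (a y) = ∫ y, g y * starRingEnd 𝕜 (a y) := fun a =>
    integral_congr_ae (by filter_upwards [h] with y hy; rw [hy])
  ext x
  simp only [trunc, shiftTrunc, shiftPiece, hint]

/-- Where the positive dyadic operator is finite, the truncations converge, and the limit agrees
with the operator on `L²` because the truncations also converge to it locally in measure. -/
theorem isValue_value (S : HaarShift 𝕜 D m k) {u : (Fin n → ℝ) → ℝ≥0∞} {f : (Fin n → ℝ) → 𝕜}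
    (h : ∀ᵐ x, u x ≠ 0 → D.posOp (volume.withDensity fun y => ‖f y‖ₑ) x < ∞) :
    S.IsValue u f (S.value f) := by
  have ht : ∀ᵐ x, u x ≠ 0 → Tendsto (fun e : ℝ × ℝ => S.trunc e.1 e.2 f x)
      (𝓝[>] 0 ×ˢ atTop) (𝓝 (S.value f x)) := by
    filter_upwards [h] with x hx hux
    exact S.tendsto_trunc_value (hx hux)
  refine ⟨ht, fun hf => ?_⟩
  have hball : ∀ r : ℕ, ∀ᵐ x, x ∈ Metric.ball (0 : Fin n → ℝ) r → u x ≠ 0 →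
      S.op (hf.toLp f) x = S.value f x := by
    intro r
    obtain ⟨e, he, hlim⟩ := (S.tendsto_trunc (hf.toLp f) r).exists_seq_tendsto_ae'
    rw [ae_restrict_iff' measurableSet_ball] at hlim
    filter_upwards [hlim, ht] with x h1 h2 hxr hux
    refine tendsto_nhds_unique (h1 hxr) (((h2 hux).comp he).congr fun i => ?_)
    exact (congrFun (S.trunc_congr_ae hf.coeFn_toLp _ _) x).symm
  filter_upwards [ae_all_iff.2 hball] with x hx
  obtain ⟨r, hr⟩ := exists_nat_gt ‖x‖
  exact hx r (mem_ball_zero_iff.2 hr)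

end HaarShift

theorem weightedNorm_mono {n : ℕ} {q : ℝ} (hq : 0 ≤ q) (u : (Fin n → ℝ) → ℝ≥0∞)
    {F G : (Fin n → ℝ) → ℝ≥0∞} (h : ∀ x, F x ≤ G x) :
    weightedNorm q u F ≤ weightedNorm q u G := by
  unfold weightedNorm
  gcongr with x
  exact h x

theorem weightedWeakNorm_mono {n : ℕ} {q : ℝ} (hq : 0 ≤ q) (u : (Fin n → ℝ) → ℝ≥0∞)
    {F G : (Fin n → ℝ) → ℝ≥0∞} (h : ∀ x, F x ≤ G x) :
    weightedWeakNorm q u F ≤ weightedWeakNorm q u G := by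
  unfold weightedWeakNorm
  gcongr with t x
  exact h x

/-! ### The two weight estimates -/

theorem theorem2 {𝕜 : Type*} [RCLike 𝕜] (n : ℕ) (hn : 0 < n) (p q : ℝ) (hp : 1 < p)
    (hpq : p < q) :
    (∀ A B : ℝ≥0, ∃ C : ℝ≥0, ∀ (D : DyadicGrid n) (m k : ℕ) (S : HaarShift 𝕜 D m k)
      (u v : (Fin n → ℝ) → ℝ≥0∞), IsWeightPair u v →
      D.MaximalBound 𝕜 p q v u A →
      D.MaximalBound 𝕜 q.conjExponent p.conjExponent
        (fun x => u x ^ (1 - q.conjExponent)) (fun x => v x ^ (1 - p.conjExponent)) B →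
      ∀ f : (Fin n → ℝ) → 𝕜, MemWeighted p v f →
        (∃ g : (Fin n → ℝ) → 𝕜, S.IsValue u f g ∧
          weightedNorm q u (fun x => ‖g x‖ₑ) ≤
            C * (max 1 S.complexity : ℕ) ^ 2 * weightedNorm p v (fun x => ‖f x‖ₑ)) ∧
        weightedNorm q u (S.maxTrunc f) ≤
          C * (max 1 S.complexity : ℕ) ^ 2 * weightedNorm p v (fun x => ‖f x‖ₑ)) ∧
    (∀ B : ℝ≥0, ∃ C : ℝ≥0, ∀ (D : DyadicGrid n) (m k : ℕ) (S : HaarShift 𝕜 D m k)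
      (u v : (Fin n → ℝ) → ℝ≥0∞), IsWeightPair u v →
      D.MaximalBound 𝕜 q.conjExponent p.conjExponent
        (fun x => u x ^ (1 - q.conjExponent)) (fun x => v x ^ (1 - p.conjExponent)) B →
      ∀ f : (Fin n → ℝ) → 𝕜, MemWeighted p v f →
        (∃ g : (Fin n → ℝ) → 𝕜, S.IsValue u f g ∧
          weightedWeakNorm q u (fun x => ‖g x‖ₑ) ≤
            C * (max 1 S.complexity : ℕ) ^ 2 * weightedNorm p v (fun x => ‖f x‖ₑ)) ∧
        weightedWeakNorm q u (S.maxTrunc f) ≤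
          C * (max 1 S.complexity : ℕ) ^ 2 * weightedNorm p v (fun x => ‖f x‖ₑ)) := by
  have hq := hp.trans hpq
  have hone : ∀ κ : ℕ, (1 : ℝ≥0∞) ≤ ((max 1 κ : ℕ) : ℝ≥0∞) ^ 2 := fun κ =>
    one_le_pow_of_one_le' (by exact_mod_cast le_max_left 1 κ) 2
  have hκ : ∀ (C x : ℝ≥0∞) (κ : ℕ), C * x ≤ C * ((max 1 κ : ℕ) : ℝ≥0∞) ^ 2 * x := fun C x κ => by
    gcongr
    exact le_mul_of_one_le_right' (hone κ)
  -- The dual bound alone gives the weak type, hence the almost everywhere finiteness of the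
  -- positive operator and the existence of the limit in both parts.
  have hvalue : ∀ (B : ℝ≥0) (D : DyadicGrid n) (m k : ℕ) (S : HaarShift 𝕜 D m k)
      (u v : (Fin n → ℝ) → ℝ≥0∞), IsWeightPair u v →
      D.MaximalBound 𝕜 q.conjExponent p.conjExponent
        (fun x => u x ^ (1 - q.conjExponent)) (fun x => v x ^ (1 - p.conjExponent)) B →
      ∀ f : (Fin n → ℝ) → 𝕜, MemWeighted p v f → S.IsValue u f (S.value f) := by
    intro B D m k S u v huv hB f hf
    refine S.isValue_value (DyadicGrid.posOp_lt_top (zero_lt_one.trans hq) huv.measurable_u ?_)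
    refine ne_top_of_le_ne_top ?_ (DyadicGrid.weightedWeakNorm_posOp_le hn hp hpq hB huv hf)
    exact ENNReal.mul_ne_top (ENNReal.mul_ne_top ENNReal.coe_ne_top
      (ENNReal.mul_ne_top (by simp) ENNReal.coe_ne_top)) hf.2.ne
  refine ⟨fun A B => ⟨DyadicGrid.formConst (1 / p) (1 / q.conjExponent) * (A + B), ?_⟩,
    fun B => ⟨DyadicGrid.formConst (1 / p) (1 / q.conjExponent) * (3 * B), ?_⟩⟩
  · intro D m k S u v huv hA hB f hf
    have hT := (DyadicGrid.weightedNorm_posOp_le hn hp hpq hA hB huv hf).trans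
      (hκ _ _ S.complexity)
    rw [ENNReal.coe_mul, ENNReal.coe_add]
    exact ⟨⟨S.value f, hvalue B D m k S u v huv hB f hf,
      (weightedNorm_mono (by linarith) u (S.enorm_value_le_posOp f)).trans hT⟩,
      (weightedNorm_mono (by linarith) u (S.maxTrunc_le_posOp f)).trans hT⟩
  · intro D m k S u v huv hB f hf
    have hT := (DyadicGrid.weightedWeakNorm_posOp_le hn hp hpq hB huv hf).trans
      (hκ _ _ S.complexity)
    rw [ENNReal.coe_mul, ENNReal.coe_mul, ENNReal.coe_ofNat]
    exact ⟨⟨S.value f, hvalue B D m k S u v huv hB f hf,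
      (weightedWeakNorm_mono (by linarith) u (S.enorm_value_le_posOp f)).trans hT⟩,
      (weightedWeakNorm_mono (by linarith) u (S.maxTrunc_le_posOp f)).trans hT⟩
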